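/- \textbf{Definitions.} Graphs are finite and simple. In the eternal vertex cover game on a graph $G$, the defender first places guards on vertices. In each of infinitely many rounds the attacker attacks an edge $uv$, and the defender answers by letting each guard either stay or move to an adjacent vertex, all at the same time, so that at least one guard moves from $u$ to $v$ or from $v$ to $u$. The eternal vertex cover number $\operatorname{evc}(G)$ is the least number of guards with which the defender can answer every sequence of attacks. The problem Eternal Vertex Cover asks, given a graph $G$ and a number $k$, whether $\operatorname{evc}(G)\le k$. A graph is cobipartite if it is the complement of a bipartite graph, that is, if its vertex set can be partitioned into two (possibly empty) cliques $A$ and $B$; write $p=|A|$ and $q=|B|$. A vertex is global if it is adjacent to all other vertices. The partition $(A,B)$ is normalized if $p\le q$ and no vertex of $A$ is global. \textbf{Theorem.} (1) There is a polynomial-time algorithm that, given a cobipartite graph $G$ (by its adjacency matrix) and a number $k$ (in binary), decides whether $\operatorname{evc}(G)\le k$. (2) Every cobipartite graph has a normalized partition into two cliques. (3) Let $G$ be a graph with at least one vertex and let $(A,B)$ be a partition of its vertices into two cliques. Then $\operatorname{evc}(G)\in\{p+q-2,\;p+q-1\}$. (4) Let $G$ be a graph with at least one vertex and let $(A,B)$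 be a normalized partition of its vertices into two cliques. Then: (a) if $p=0$, then $\operatorname{evc}(G)=p+q-1$; (b) if $p=1$, then $\operatorname{evc}(G)=p+q-2$ if and only if the vertex of $A$ has no neighbour in $B$; (c) if $p=q=2$, then $\operatorname{evc}(G)=p+q-2$ if and only if either there is no edge between $A$ and $B$, or the edges between $A$ and $B$ form a perfect matching; (d) if $p=2$ and $q>2$, then $\operatorname{evc}(G)=p+q-1$ if and only if exactly one vertex of $A$ has a neighbour in $B$, or exactly one vertex of $B$ is not global; (e) if $p\ge 3$, then $\operatorname{evc}(G)=p+q-1$ if and only if exactly one vertex of $B$ is not global. -/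

import Mathlib

universe u

namespace EVC

/-! ### The game -/

/-- With the guards `g` standing on the vertices `f g`, the edge `e` is attacked and the defender
answers by moving every guard `g` to `f' g`: each guard stays or crosses one edge (all of them
simultaneously), and at least one guard crosses the attacked edge, in one of the two directions. -/
def Defends {V : Type u} (G : SimpleGraph V) {k : ℕ} (e : Sym2 V) (f f' : Fin k → V) : Prop :=
  (∀ g, f' g = f g ∨ G.Adj (f g) (f' g)) ∧ ∃ g, s(f g, f' g) = e

/-- The defender has a winning strategy with `k` guards. A strategy assigns to every finite history
of attacks (most recent attack first) the position of the guards after the defender's last answer;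
`σ []` is the initial placement. It wins if every further attack is defended. -/
def GuardsWin {V : Type u} (G : SimpleGraph V) (k : ℕ) : Prop :=
  ∃ σ : List G.edgeSet → (Fin k → V),
    ∀ (h : List G.edgeSet) (e : G.edgeSet), Defends G (e : Sym2 V) (σ h) (σ (e :: h))

/-- The eternal vertex cover number: the least number of guards with which the defender wins. -/
noncomputable def evc {V : Type u} (G : SimpleGraph V) : ℕ :=
  sInf {k | GuardsWin G k}

/-- On a finite graph the infimum defining `evc` is over a nonempty set: a guard on every vertex
suffices. -/
theorem guardsWin_card {V : Type u} [Fintype V] (G : SimpleGraph V) :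
    GuardsWin G (Fintype.card V) := by
  classical
  let sw : G.edgeSet → Equiv.Perm V := fun e =>
    Equiv.swap (Quot.out (e : Sym2 V)).1 (Quot.out (e : Sym2 V)).2
  let τ : List G.edgeSet → (Fin (Fintype.card V) ≃ V) := fun h =>
    h.foldr (fun e p => p.trans (sw e)) (Fintype.equivFin V).symm
  refine ⟨fun h => τ h, fun h e => ?_⟩
  have hout : s((Quot.out (e : Sym2 V)).1, (Quot.out (e : Sym2 V)).2) = (e : Sym2 V) :=
    Quot.out_eq (e : Sym2 V)
  have hadj : G.Adj (Quot.out (e : Sym2 V)).1 (Quot.out (e : Sym2 V)).2 := by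
    have h2 := e.2
    rw [← hout] at h2
    exact h2
  have hstep : ∀ g, τ (e :: h) g = sw e (τ h g) := fun g => rfl
  refine ⟨fun g => ?_, (τ h).symm (Quot.out (e : Sym2 V)).1, ?_⟩ <;> beta_reduce
  · rw [hstep]
    by_cases h1 : τ h g = (Quot.out (e : Sym2 V)).1
    · right
      rw [h1]
      simpa [sw] using hadj
    · by_cases h2 : τ h g = (Quot.out (e : Sym2 V)).2
      · right
        rw [h2]
        simpa [sw] using hadj.symm
      · left
        exact Equiv.swap_apply_of_ne_of_ne h1 h2
  · rw [hstep]
    simpa [sw] using hout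

/-! ### Cobipartite graphs -/

/-- A graph is cobipartite if it is the complement of a bipartite graph. -/
def IsCobipartite {V : Type u} (G : SimpleGraph V) : Prop :=
  Gᶜ.IsBipartite

/-- `A`, `B` is a partition of the vertex set into two (possibly empty) cliques. -/
structure IsCliquePartition {V : Type u} (G : SimpleGraph V) (A B : Finset V) : Prop where
  disjoint : Disjoint A B
  cover : ∀ v, v ∈ A ∨ v ∈ B
  clique_left : G.IsClique (A : Set V)
  clique_right : G.IsClique (B : Set V)

/-- A vertex is global if it is adjacent to all other vertices. -/
def IsGlobal {V : Type u} (G : SimpleGraph V) (v : V) : Prop :=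
  ∀ w, w ≠ v → G.Adj v w

/-- A clique partition is normalized if `A` is not larger than `B` and has no global vertex. -/
structure IsNormalizedPartition {V : Type u} (G : SimpleGraph V) (A B : Finset V) : Prop
    extends IsCliquePartition G A B where
  card_le : A.card ≤ B.card
  not_global : ∀ a ∈ A, ¬ IsGlobal G a

/-! ### The decision problem and polynomial time -/

/-- An instance: a graph on the vertex set `Fin n` and a number `k`. -/
structure Instance where
  n : ℕ
  graph : SimpleGraph (Fin n)
  k : ℕ

open Computability in
open Classical in
/-- An instance is written as the binary representation of `k`, an end marker, and the rows of the
adjacency matrix of the graph, each followed by a comma. -/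
noncomputable def Instance.encode (x : Instance) : List Computability.Γ' :=
  (encodeNat x.k).map Γ'.bit ++ [Γ'.ket] ++
    (List.finRange x.n).flatMap fun i =>
      (List.finRange x.n).map (fun j => Γ'.bit (decide (x.graph.Adj i j))) ++ [Γ'.comma]

open Classical in
/-- The problem `Q`, restricted to the instances in the class `C`, can be decided in polynomial
time: some multi-stack Turing machine with finite alphabets, started on the encoding of any instance
in `C`, halts with the correct answer within a number of steps that is bounded by a polynomial in
the length of the encoding. -/
def PolyTimeDecidableOn (C : Set Instance) (Q : Instance → Prop) : Prop :=
  ∃ M : Turing.TM2ComputableInPolyTime (fun x : C => x.1.encode) Computability.encodeBool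
      (fun x : C => decide (Q x.1)),
    ∀ s, Finite (M.tm.Γ s)

end EVC

/-! A position is best described by its unoccupied vertices. They are pairwise non-adjacent, since
an edge with two unoccupied ends cannot be defended. So each clique contains at most one of them,
and at least n - 2 guards are needed, where n = p + q. On the other hand n - 1 guards always
suffice: swap the contents of the two ends of the attacked edge.

With n - 2 guards exactly one vertex of each clique is unoccupied (`exists_unoccupied`), and the
game consists in moving a non-adjacent pair. There are three obstructions. If p = 1, the vertex of A
is never occupied, so it must have no neighbour. If B has at least two vertices but only one that is
not global, that one is never occupied, although it has a neighbour in B. If p = 2 and only one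
vertex of A has neighbours in B, an attack across the cliques fills A completely. For p ≥ 2 nothing
else can go wrong (`IsNormalizedPartition.guardsWin`): the cross edges do not all meet in one
vertex, or form a star with at least two edges, or reduce to a single edge, and each situation has
its own family of pairs that the defender can maintain (`guardsWin_of_responds`).

For the algorithm, the partition is eliminated: evc is n - 1 iff the complement is a star (possibly
without edges) with a further isolated vertex, or the graph has a suitable pendant vertex. Because
the complement has no triangle, both conditions can be read off from n, the number of zeros of the
adjacency matrix and the largest number of zeros in a row (`IsCobipartite.evc_le_iff`). A
multi-stack machine maintains four linear forms in these numbers as signed unary counters, and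
compares n with k by decrementing the binary number k once per row. -/

namespace EVC

/-! ### Winning strategies from invariants -/

section Strategies

variable {V : Type u} {G : SimpleGraph V}

/-- A nonempty set of placements that can be maintained under every attack yields a winning
strategy. -/
theorem guardsWin_of_invariant {k : ℕ} (P : (Fin k → V) → Prop) (h0 : ∃ f, P f)
    (hstep : ∀ f, P f → ∀ e : G.edgeSet, ∃ f', P f' ∧ Defends G (e : Sym2 V) f f') :
    GuardsWin G k := by
  choose! next hnext hdef using hstep
  obtain ⟨f0, hf0⟩ := h0
  let σ : List G.edgeSet → (Fin k → V) := fun h => h.foldr (fun e f => next f e) f0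
  have hσ : ∀ h, P (σ h) := by
    intro h
    induction h with
    | nil => exact hf0
    | cons e h ih => exact hnext _ ih e
  exact ⟨σ, fun h e => hdef _ (hσ h) e⟩

/-- All guards but one of a full placement suffice. -/
theorem guardsWin_card_sub_one [Fintype V] [Nonempty V] :
    GuardsWin G (Fintype.card V - 1) := by
  classical
  have hpos : 0 < Fintype.card V := Fintype.card_pos
  refine guardsWin_of_invariant (fun f => Function.Injective f) ?_ ?_
  · have : Nonempty (Fin (Fintype.card V - 1) ↪ V) := by
      rw [Function.Embedding.nonempty_iff_card_le]
      simp
    obtain ⟨f⟩ := this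
    exact ⟨f, f.injective⟩
  · rintro f hf ⟨e, he⟩
    induction e with | _ u v
    have hadj : G.Adj u v := he
    -- Composing with the transposition of the two ends keeps the placement injective, and it is a
    -- valid answer whether one end or both are occupied. Both cannot be empty, as only one vertex
    -- is.
    refine ⟨fun g => Equiv.swap u v (f g), (Equiv.injective _).comp hf, fun g => ?_, ?_⟩
    · by_cases h1 : f g = u
      · right; simpa [h1] using hadj
      by_cases h2 : f g = v
      · right; simpa [h2] using hadj.symm
      left
      exact Equiv.swap_apply_of_ne_of_ne h1 h2
    · have : ∃ g, f g = u ∨ f g = v := by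
        by_contra! hcon
        have hsub : Finset.univ.image f ⊆ (Finset.univ.erase u).erase v := by
          intro x hx
          obtain ⟨g, -, rfl⟩ := Finset.mem_image.1 hx
          simp [hcon g]
        have hc := Finset.card_le_card hsub
        rw [Finset.card_image_of_injective _ hf, Finset.card_erase_of_mem (by simp [hadj.ne']),
          Finset.card_erase_of_mem (Finset.mem_univ _)] at hc
        simp only [Finset.card_univ, Fintype.card_fin] at hc
        have : 1 < Fintype.card V := Fintype.one_lt_card_iff.2 ⟨u, v, hadj.ne⟩
        omega
      obtain ⟨g, hg | hg⟩ := this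
      · exact ⟨g, by simp [hg]⟩
      · exact ⟨g, by simp [hg, Sym2.eq_swap]⟩

/-- The unoccupied vertices are `x` and `y`, and the edge `ux` is attacked: the guard on `u` moves
to `x`, a guard on `w` (if `w ≠ u`) moves to `u`, a guard on `t` (if `t ≠ y`) moves to `y`, and a
guard on `s` (if `s ≠ t`) moves to `t`. The new unoccupied vertices `w` and `s` are related
by `R`, in one of the two orders. -/
def Responds (G : SimpleGraph V) (R : V → V → Prop) (x y u : V) : Prop :=
  ∃ w t s, (w = u ∨ G.Adj w u) ∧ (t = y ∨ G.Adj t y) ∧ (s = t ∨ G.Adj s t) ∧ (t = y ↔ s = y) ∧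
    w ≠ x ∧ w ≠ y ∧ t ≠ x ∧ s ≠ x ∧ t ≠ u ∧ s ≠ u ∧ t ≠ w ∧ s ≠ w ∧ (R w s ∨ R s w)

/-- The guards move along two chains w → u → x and s → t → y. The inequalities in `Responds` make
the chains disjoint, so the move is injective. The chains may degenerate: w = u leaves u empty, s =
t shortens the second chain, and s = t = y suppresses it. -/
theorem Responds.exists_move [DecidableEq V] {R : V → V → Prop} {x y u : V} (h : Responds G R x y u)
    (hxy : x ≠ y) (hu : G.Adj u x) (huy : u ≠ y) :
    ∃ (x' y' : V) (m : V → V), (R x' y' ∨ R y' x') ∧ (∀ z, z ≠ x → z ≠ y → m z ≠ x' ∧ m z ≠ y') ∧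
      (∀ z, z ≠ x → z ≠ y → m z = z ∨ G.Adj z (m z)) ∧
      (∀ z z', z ≠ x → z ≠ y → z' ≠ x → z' ≠ y → m z = m z' → z = z') ∧ m u = x := by
  obtain ⟨w, t, s, hw, ht, hs, hts, h1, h2, h3, h4, h5, h6, h7, h8, hR⟩ := h
  have hux := hu.ne
  refine ⟨w, s, fun z => if z = u then x else if z = w then u else if z = t then y else
    if z = s then t else z, hR, ?_, ?_, ?_, ?_⟩
  · intro z hz hz'
    grind
  · intro z hz hz'
    grind
  · intro z z' a b c d
    grind
  · simp

/-- A family of unoccupied pairs that can be maintained under every attack on an unoccupied vertex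
yields a winning strategy with `|V| - 2` guards. -/
theorem guardsWin_of_responds [Fintype V] (R : V → V → Prop) (h0 : ∃ x y, R x y)
    (hne : ∀ x y, R x y → x ≠ y) (hadj : ∀ x y, R x y → ¬ G.Adj x y)
    (hx : ∀ x y, R x y → ∀ u, G.Adj u x → Responds G R x y u)
    (hy : ∀ x y, R x y → ∀ u, G.Adj u y → Responds G R y x u) :
    GuardsWin G (Fintype.card V - 2) := by
  classical
  refine guardsWin_of_invariant (fun f => Function.Injective f ∧
    ∃ x y, R x y ∧ ∀ g, f g ≠ x ∧ f g ≠ y) ?_ ?_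
  · obtain ⟨x, y, h⟩ := h0
    have hxy := hne x y h
    have : Nonempty (Fin (Fintype.card V - 2) ↪ {z : V // z ≠ x ∧ z ≠ y}) := by
      rw [Function.Embedding.nonempty_iff_card_le, Fintype.card_fin, Fintype.card_subtype]
      have : (Finset.univ.filter fun z => z ≠ x ∧ z ≠ y) = (Finset.univ.erase x).erase y := by
        ext z; simp [and_comm]
      rw [this, Finset.card_erase_of_mem (by simp [hxy.symm]),
        Finset.card_erase_of_mem (Finset.mem_univ _), Finset.card_univ]
      omega
    obtain ⟨f⟩ := this
    exact ⟨fun g => (f g).1, fun a b hab => f.injective (Subtype.ext hab), x, y, h,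
      fun g => (f g).2⟩
  · rintro f ⟨hf, x, y, hR, hfxy⟩ ⟨e, he⟩
    have hxy := hne x y hR
    have hcov : ∀ z, z ≠ x → z ≠ y → ∃ g, f g = z := by
      by_contra! hcon
      obtain ⟨z, hzx, hzy, hz⟩ := hcon
      have hsub : Finset.univ.image f ⊆ ((Finset.univ.erase x).erase y).erase z := by
        intro v hv
        obtain ⟨g, -, rfl⟩ := Finset.mem_image.1 hv
        simp [hz g, hfxy g]
      have hc := Finset.card_le_card hsub
      rw [Finset.card_image_of_injective _ hf, Finset.card_erase_of_mem (by simp [hzx, hzy]),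
        Finset.card_erase_of_mem (by simp [hxy.symm]),
        Finset.card_erase_of_mem (Finset.mem_univ _)] at hc
      simp only [Finset.card_univ, Fintype.card_fin] at hc
      have : 2 < Fintype.card V := Fintype.two_lt_card_iff.2 ⟨x, y, z, hxy, hzx.symm, hzy.symm⟩
      omega
    -- The move `m` need only be controlled on occupied vertices. Stating this for arbitrary x and y
    -- lets it serve attacks on either unoccupied vertex, and on neither.
    have key : ∀ x y : V, (∀ g, f g ≠ x ∧ f g ≠ y) → ∀ (x' y' : V) (m : V → V),
        (∀ z, z ≠ x → z ≠ y → m z ≠ x' ∧ m z ≠ y') →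
        (∀ z, z ≠ x → z ≠ y → m z = z ∨ G.Adj z (m z)) →
        (∀ z z', z ≠ x → z ≠ y → z' ≠ x → z' ≠ y → m z = m z' → z = z') →
        (∃ g, s(f g, m (f g)) = e) → (R x' y' ∨ R y' x') →
        ∃ f', (Function.Injective f' ∧ ∃ x y, R x y ∧ ∀ g, f' g ≠ x ∧ f' g ≠ y) ∧
          Defends G e f f' := by
      intro x y hfxy x' y' m h1 h2 h3 h4 h5
      refine ⟨fun g => m (f g), ⟨fun a b hab => hf (h3 _ _ (hfxy a).1 (hfxy a).2 (hfxy b).1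
        (hfxy b).2 hab), ?_⟩, fun g => h2 _ (hfxy g).1 (hfxy g).2, h4⟩
      rcases h5 with h5 | h5
      · exact ⟨x', y', h5, fun g => h1 _ (hfxy g).1 (hfxy g).2⟩
      · exact ⟨y', x', h5, fun g => (h1 _ (hfxy g).1 (hfxy g).2).symm⟩
    have hxatt : ∀ u, G.Adj u x → s(u, x) = e →
        ∃ f', (Function.Injective f' ∧ ∃ x y, R x y ∧ ∀ g, f' g ≠ x ∧ f' g ≠ y) ∧
          Defends G e f f' := by
      intro u hu hue
      -- Non-adjacency of the unoccupied pair guarantees a guard on the other end of the attacked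
      -- edge.
      have huy : u ≠ y := by rintro rfl; exact hadj _ _ hR hu.symm
      obtain ⟨x', y', m, h1, h2, h3, h4, h5⟩ := (hx x y hR u hu).exists_move hxy hu huy
      obtain ⟨g, hg⟩ := hcov u hu.ne huy
      exact key x y hfxy x' y' m h2 h3 h4 ⟨g, by rw [hg, h5, hue]⟩ h1
    have hyatt : ∀ u, G.Adj u y → s(u, y) = e →
        ∃ f', (Function.Injective f' ∧ ∃ x y, R x y ∧ ∀ g, f' g ≠ x ∧ f' g ≠ y) ∧
          Defends G e f f' := by
      intro u hu hue
      have hux : u ≠ x := by rintro rfl; exact hadj _ _ hR hu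
      obtain ⟨x', y', m, h1, h2, h3, h4, h5⟩ := (hy x y hR u hu).exists_move hxy.symm hu hux
      obtain ⟨g, hg⟩ := hcov u hux hu.ne
      exact key y x (fun g => (hfxy g).symm) x' y' m h2 h3 h4 ⟨g, by rw [hg, h5, hue]⟩ h1
    induction e with | _ u v
    have huv : G.Adj u v := he
    by_cases hux : u = x
    · exact hxatt v (hux ▸ huv.symm) (by rw [hux, Sym2.eq_swap])
    by_cases huy : u = y
    · exact hyatt v (huy ▸ huv.symm) (by rw [huy, Sym2.eq_swap])
    by_cases hvx : v = x
    · exact hxatt u (hvx ▸ huv) (by rw [hvx])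
    by_cases hvy : v = y
    · exact hyatt u (hvy ▸ huv) (by rw [hvy])
    obtain ⟨g, hg⟩ := hcov u hux huy
    -- Both ends are occupied: their guards change places and the unoccupied pair is unchanged.
    refine key x y hfxy x y (Equiv.swap u v) ?_ ?_ ?_ ⟨g, by simp [hg]⟩ (Or.inl hR)
    · intro z hz hz'
      rw [Equiv.swap_apply_def]
      grind
    · intro z hz hz'
      rw [Equiv.swap_apply_def]
      have := huv.symm
      grind
    · intro z z' _ _ _ _ h
      exact (Equiv.swap u v).injective h

end Strategies

end EVC

namespace EVC

/-! ### Two cliques: strategies and lower bounds -/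

section Cobipartite

variable {V : Type u} {G : SimpleGraph V} {A B : Finset V}

theorem IsCliquePartition.symm (h : IsCliquePartition G A B) : IsCliquePartition G B A :=
  ⟨h.disjoint.symm, fun v => (h.cover v).symm, h.clique_right, h.clique_left⟩

theorem IsCliquePartition.card_add_card [Fintype V] (h : IsCliquePartition G A B) :
    A.card + B.card = Fintype.card V := by
  classical
  rw [← Finset.card_union_of_disjoint h.disjoint, ← Finset.card_univ]
  congr 1
  ext v
  simpa using h.cover v

theorem IsCliquePartition.notMem_right (h : IsCliquePartition G A B) {v : V} (hv : v ∈ A) :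
    v ∉ B :=
  Finset.disjoint_left.1 h.disjoint hv

theorem IsCliquePartition.adj_left (h : IsCliquePartition G A B) {v w : V} (hv : v ∈ A)
    (hw : w ∈ A) (hvw : v ≠ w) : G.Adj v w :=
  h.clique_left hv hw hvw

theorem IsCliquePartition.adj_right (h : IsCliquePartition G A B) {v w : V} (hv : v ∈ B)
    (hw : w ∈ B) (hvw : v ≠ w) : G.Adj v w :=
  h.clique_right hv hw hvw

theorem IsCliquePartition.exists_not_adj_of_left (h : IsCliquePartition G A B) {a : V}
    (ha : a ∈ A) (hg : ¬ IsGlobal G a) : ∃ b ∈ B, ¬ G.Adj a b := by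
  simp only [IsGlobal, not_forall] at hg
  obtain ⟨b, hba, hab⟩ := hg
  refine ⟨b, (h.cover b).resolve_left fun hb => hab (h.adj_left ha hb (Ne.symm hba)), hab⟩

theorem IsCliquePartition.not_global_right_iff (h : IsCliquePartition G A B) {b : V}
    (hb : b ∈ B) : ¬ IsGlobal G b ↔ ∃ a ∈ A, ¬ G.Adj a b := by
  constructor
  · intro hg
    obtain ⟨a, ha, hab⟩ := h.symm.exists_not_adj_of_left hb hg
    exact ⟨a, ha, fun h' => hab h'.symm⟩
  · rintro ⟨a, ha, hab⟩ hg
    exact hab (hg a (fun e => h.notMem_right ha (e ▸ hb))).symm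

/-! ### Strategies with `|V| - 2` guards -/

/-- If the edges between the cliques do not all meet in one vertex, then the unoccupied vertices can
be any two non-adjacent vertices of different cliques. -/
theorem IsCliquePartition.guardsWin_of_not_star [Fintype V] (h : IsCliquePartition G A B)
    (hA : ∀ a ∈ A, ∃ b ∈ B, ¬ G.Adj a b)
    (hB : ∃ b ∈ B, ∃ b' ∈ B, b ≠ b' ∧ (∃ a ∈ A, ¬ G.Adj a b) ∧ ∃ a ∈ A, ¬ G.Adj a b')
    (hstarA : ∀ a ∈ A, ∀ b ∈ B, G.Adj a b → ∃ a' ∈ A, ∃ b' ∈ B, a' ≠ a ∧ G.Adj a' b')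
    (hstarB : ∀ a ∈ A, ∀ b ∈ B, G.Adj a b → ∃ a' ∈ A, ∃ b' ∈ B, b' ≠ b ∧ G.Adj a' b') :
    GuardsWin G (Fintype.card V - 2) := by
  have hdis : ∀ v, v ∈ A → v ∉ B := fun v => h.notMem_right
  have hcov := h.cover
  have hcA : ∀ v w, v ∈ A → w ∈ A → v ≠ w → G.Adj v w := fun v w => h.adj_left
  have hcB : ∀ v w, v ∈ B → w ∈ B → v ≠ w → G.Adj v w := fun v w => h.adj_right
  have hs : ∀ v w, G.Adj v w → G.Adj w v := fun v w e => e.symm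
  have hirr : ∀ v, ¬ G.Adj v v := fun v => G.irrefl
  refine guardsWin_of_responds (fun a b => a ∈ A ∧ b ∈ B ∧ ¬ G.Adj a b) ?_ ?_ ?_ ?_ ?_
  · obtain ⟨b, hb, -, -, -, ⟨a, ha, hab⟩, -⟩ := hB
    exact ⟨a, b, ha, hb, hab⟩
  · rintro a b ⟨ha, hb, -⟩ rfl
    exact hdis a ha hb
  · exact fun a b h => h.2.2
  · rintro a b ⟨ha, hb, hab⟩ u hu
    -- If the guard comes from A, the vacancy in A moves to u, and the vacancy in B is shifted to a
    -- non-neighbour of u when necessary. If it comes from B, a neighbour of u in A other than a can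
    -- refill u. Failing that, the vacancy in B is now u, whose only neighbour in A is a, and some
    -- guard of A must leave to fill b: directly if b has a neighbour in A, else through an edge xy
    -- with x ≠ a, by x → y → b.
    rcases hcov u with huA | huB
    · obtain ⟨b', hb', hub'⟩ := hA u huA
      by_cases hub : G.Adj u b
      · exact ⟨u, b', b', by grind⟩
      · exact ⟨u, b, b, by grind⟩
    · by_cases h1 : ∃ x ∈ A, x ≠ a ∧ G.Adj x u
      · obtain ⟨x, hx, hxa, hxu⟩ := h1
        obtain ⟨b', hb', hxb'⟩ := hA x hx
        by_cases hxb : G.Adj x b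
        · exact ⟨x, b', b', by grind⟩
        · exact ⟨x, b, b, by grind⟩
      · push Not at h1
        obtain ⟨x, hx, y, hy, hxa, hxy⟩ := hstarA a ha u huB hu.symm
        by_cases h2 : ∃ z ∈ A, G.Adj z b
        · obtain ⟨z, hz, hzb⟩ := h2
          exact ⟨u, z, z, by grind⟩
        · push Not at h2
          exact ⟨u, y, x, by grind⟩
  · rintro a b ⟨ha, hb, hab⟩ u hu
    -- When u lies in A, a guard of B has to replace the one that crosses. It enters a directly, or
    -- refills u, or enters x along an edge xy with y ≠ b while the guard on x moves to a.
    rcases hcov u with huA | huB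
    · obtain ⟨b', hb', hub'⟩ := hA u huA
      by_cases h1 : ∃ v ∈ B, G.Adj a v
      · obtain ⟨v, hv, hav⟩ := h1
        by_cases huv : G.Adj u v
        · exact ⟨u, v, b', by grind⟩
        · exact ⟨u, v, v, by grind⟩
      · push Not at h1
        by_cases h2 : ∃ v ∈ B, v ≠ b ∧ G.Adj u v
        · obtain ⟨v, hv, hvb, huv⟩ := h2
          exact ⟨v, a, a, by grind⟩
        · push Not at h2
          obtain ⟨x, hx, y, hy, hyb, hxy⟩ := hstarB u huA b hb hu
          exact ⟨u, x, y, by grind⟩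
    · by_cases hg : ∃ a' ∈ A, ¬ G.Adj a' u
      · obtain ⟨a', ha', hau'⟩ := hg
        by_cases hau : G.Adj a u
        · exact ⟨u, a', a', by grind⟩
        · exact ⟨u, a, a, by grind⟩
      -- No vertex of A is a non-neighbour of u, so u cannot become the vacancy of B. The guard on a
      -- second non-global vertex c refills u, and c becomes the vacancy.
      · push Not at hg
        obtain ⟨c, hc, hcb, a', ha', hac'⟩ : ∃ c ∈ B, c ≠ b ∧ ∃ a' ∈ A, ¬ G.Adj a' c := by
          obtain ⟨c, hc, c', hc', hcc, h1, h2⟩ := hB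
          by_cases hcb : c = b
          · exact ⟨c', hc', by grind, h2⟩
          · exact ⟨c, hc, hcb, h1⟩
        by_cases hau : G.Adj a c
        · exact ⟨c, a', a', by grind⟩
        · exact ⟨c, a, a, by grind⟩

/-- If at least two edges between the cliques exist and they all meet in a vertex `c` of `A`, then
the unoccupied vertices can be any vertex of `A` except `c` and any vertex of `B`. -/
theorem IsCliquePartition.guardsWin_of_star [Fintype V] (h : IsCliquePartition G A B)
    (hA : 3 ≤ A.card) {c b₁ b₂ : V} (hc : c ∈ A) (hb₁ : b₁ ∈ B) (hb₂ : b₂ ∈ B) (hb : b₁ ≠ b₂)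
    (h₁ : G.Adj c b₁) (h₂ : G.Adj c b₂) (hstar : ∀ a ∈ A, ∀ b ∈ B, G.Adj a b → a = c) :
    GuardsWin G (Fintype.card V - 2) := by
  classical
  have hdis : ∀ v, v ∈ A → v ∉ B := fun v => h.notMem_right
  have hcov := h.cover
  have hcA : ∀ v w, v ∈ A → w ∈ A → v ≠ w → G.Adj v w := fun v w => h.adj_left
  have hcB : ∀ v w, v ∈ B → w ∈ B → v ≠ w → G.Adj v w := fun v w => h.adj_right
  have hs : ∀ v w, G.Adj v w → G.Adj w v := fun v w e => e.symm
  have hirr : ∀ v, ¬ G.Adj v v := fun v => G.irrefl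
  have hthird : ∀ x y, ∃ z ∈ A, z ≠ x ∧ z ≠ y := fun x y => by
    obtain ⟨z, hz, hz'⟩ := Finset.exists_mem_notMem_of_card_lt_card
      (s := {x, y}) (t := A) (Finset.card_le_two.trans_lt hA)
    exact ⟨z, hz, by simpa using hz'⟩
  refine guardsWin_of_responds (fun a b => a ∈ A ∧ a ≠ c ∧ b ∈ B) ?_ ?_ ?_ ?_ ?_
  · obtain ⟨z, hz, hzc, -⟩ := hthird c c
    exact ⟨z, b₁, hz, hzc, hb₁⟩
  · rintro a b ⟨ha, -, hb⟩ rfl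
    exact hdis a ha hb
  · exact fun a b h hab => h.2.1 (hstar a h.1 b h.2.2 hab)
  · rintro a b ⟨ha, hac, hb⟩ u hu
    -- The third vertex of A refills the centre when the guard on the centre answers the attack.
    obtain ⟨z, hz, hzc, hza⟩ := hthird c a
    by_cases huc : u = c
    · exact ⟨z, b, b, by grind⟩
    · exact ⟨u, b, b, by grind⟩
  · rintro a b ⟨ha, hac, hb⟩ u hu
    by_cases huB : u ∈ B
    · exact ⟨u, a, a, by grind⟩
    -- Only the centre c can cross to b. It is refilled through another cross edge, which is why two
    -- of them are needed.
    · obtain ⟨v, hv, hvb, hcv⟩ : ∃ v ∈ B, v ≠ b ∧ G.Adj c v := by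
        by_cases h : b₁ = b
        · exact ⟨b₂, hb₂, by grind, h₂⟩
        · exact ⟨b₁, hb₁, h, h₁⟩
      exact ⟨v, a, a, by grind⟩

/-- If there is exactly one edge between the cliques, then the unoccupied vertices can be any two
vertices of different cliques that are not incident with it. -/
theorem IsCliquePartition.guardsWin_of_single_edge [Fintype V] (h : IsCliquePartition G A B)
    (hA : 3 ≤ A.card) (hB : 3 ≤ B.card) {c d : V} (hc : c ∈ A) (hd : d ∈ B)
    (hstar : ∀ a ∈ A, ∀ b ∈ B, G.Adj a b → a = c ∧ b = d) :
    GuardsWin G (Fintype.card V - 2) := by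
  classical
  have hdis : ∀ v, v ∈ A → v ∉ B := fun v => h.notMem_right
  have hcov := h.cover
  have hcA : ∀ v w, v ∈ A → w ∈ A → v ≠ w → G.Adj v w := fun v w => h.adj_left
  have hcB : ∀ v w, v ∈ B → w ∈ B → v ≠ w → G.Adj v w := fun v w => h.adj_right
  have hs : ∀ v w, G.Adj v w → G.Adj w v := fun v w e => e.symm
  have hirr : ∀ v, ¬ G.Adj v v := fun v => G.irrefl
  have hthird : ∀ C : Finset V, 3 ≤ C.card → ∀ x y, ∃ z ∈ C, z ≠ x ∧ z ≠ y := fun C hC x y => by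
    obtain ⟨z, hz, hz'⟩ := Finset.exists_mem_notMem_of_card_lt_card
      (s := {x, y}) (t := C) (Finset.card_le_two.trans_lt hC)
    exact ⟨z, hz, by simpa using hz'⟩
  refine guardsWin_of_responds (fun a b => (a ∈ A ∧ a ≠ c) ∧ b ∈ B ∧ b ≠ d) ?_ ?_ ?_ ?_ ?_
  · obtain ⟨z, hz, hzc, -⟩ := hthird A hA c c
    obtain ⟨y, hy, hyd, -⟩ := hthird B hB d d
    exact ⟨z, y, ⟨hz, hzc⟩, hy, hyd⟩
  · rintro a b ⟨ha, hb⟩ rfl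
    exact hdis a ha.1 hb.1
  · exact fun a b h hab => h.1.2 (hstar a h.1.1 b h.2.1 hab).1
  · rintro a b ⟨⟨ha, hac⟩, hb, hbd⟩ u hu
    -- No guard ever crosses: the vacancies avoid both c and d, so every attack on a vacancy comes
    -- from its own clique. The spare vertex refills c if its guard moves.
    obtain ⟨z, hz, hzc, hza⟩ := hthird A hA c a
    by_cases huc : u = c
    · exact ⟨z, b, b, by grind⟩
    · exact ⟨u, b, b, by grind⟩
  · rintro a b ⟨⟨ha, hac⟩, hb, hbd⟩ u hu
    obtain ⟨z, hz, hzc, hza⟩ := hthird B hB d b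
    by_cases huc : u = d
    · exact ⟨z, a, a, by grind⟩
    · exact ⟨u, a, a, by grind⟩

/-! ### Lower bounds -/

theorem Defends.mem_range {k : ℕ} {u v : V} {f f' : Fin k → V} (h : Defends G s(u, v) f f') :
    (∃ g, f g = u) ∨ ∃ g, f g = v := by
  obtain ⟨-, g, hg⟩ := h
  rcases Sym2.eq_iff.1 hg with ⟨h1, -⟩ | ⟨h1, -⟩
  exacts [Or.inl ⟨g, h1⟩, Or.inr ⟨g, h1⟩]

/-- Two unoccupied vertices of a clique would span an undefendable edge, so the guards inside the
clique miss at most one of its vertices. -/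
theorem card_le_of_occupies_clique [DecidableEq V] {k : ℕ} {f : Fin k → V} (C : Finset V)
    (hC : G.IsClique (C : Set V))
    (hf : ∀ u v, G.Adj u v → (∃ g, f g = u) ∨ ∃ g, f g = v) :
    C.card ≤ (Finset.univ.filter fun g => f g ∈ C).card + 1 := by
  have h1 : (C \ (Finset.univ.filter fun g => f g ∈ C).image f).card ≤ 1 := by
    rw [Finset.card_le_one]
    intro a ha b hb
    by_contra hab
    simp only [Finset.mem_sdiff, Finset.mem_image, Finset.mem_filter, Finset.mem_univ,
      true_and, not_exists, not_and] at ha hb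
    rcases hf a b (hC ha.1 hb.1 hab) with ⟨g, hg⟩ | ⟨g, hg⟩
    · exact ha.2 g (hg ▸ ha.1) hg
    · exact hb.2 g (hg ▸ hb.1) hg
  have h2 := Finset.card_le_card_sdiff_add_card (s := C)
    (t := (Finset.univ.filter fun g => f g ∈ C).image f)
  have h3 : ((Finset.univ.filter fun g => f g ∈ C).image f).card ≤ _ := Finset.card_image_le
  omega

theorem IsCliquePartition.card_le_of_guardsWin [Fintype V] (h : IsCliquePartition G A B) {k : ℕ}
    (hk : GuardsWin G k) : Fintype.card V ≤ k + 2 := by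
  classical
  obtain ⟨σ, hσ⟩ := hk
  have hf : ∀ u v, G.Adj u v → (∃ g, σ [] g = u) ∨ ∃ g, σ [] g = v :=
    fun u v huv => (hσ [] ⟨s(u, v), huv⟩).mem_range
  have hA := card_le_of_occupies_clique A h.clique_left hf
  have hB := card_le_of_occupies_clique B h.clique_right hf
  have hdis : Disjoint (Finset.univ.filter fun g => σ [] g ∈ A)
      (Finset.univ.filter fun g => σ [] g ∈ B) := by
    rw [Finset.disjoint_filter]
    exact fun g _ => h.notMem_right
  have := Finset.card_union_of_disjoint hdis ▸
    Finset.card_le_univ (Finset.univ.filter (fun g => σ [] g ∈ A) ∪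
      Finset.univ.filter fun g => σ [] g ∈ B)
  have := h.card_add_card
  simp only [Fintype.card_fin] at *
  omega

theorem guardsWin_evc [Fintype V] (G : SimpleGraph V) : GuardsWin G (evc G) :=
  Nat.sInf_mem (s := {k | GuardsWin G k}) ⟨_, guardsWin_card G⟩

theorem evc_le {k : ℕ} (h : GuardsWin G k) : evc G ≤ k :=
  Nat.sInf_le h

/-- The lower bound sums the clique bound over A and B; the upper bound is `guardsWin_card_sub_one`.
Adding constants to `evc` avoids truncated subtraction. -/
theorem IsCliquePartition.evc_eq [Fintype V] [Nonempty V] (h : IsCliquePartition G A B) :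
    evc G + 2 = A.card + B.card ∨ evc G + 1 = A.card + B.card := by
  have h1 := h.card_le_of_guardsWin (guardsWin_evc G)
  have h2 := evc_le (guardsWin_card_sub_one (G := G))
  have h3 := h.card_add_card
  have : 0 < Fintype.card V := Fintype.card_pos
  omega

/-- With `|V| - 2` guards, exactly one vertex of each clique is unoccupied, and every other vertex
carries one guard. -/
theorem IsCliquePartition.exists_unoccupied [Fintype V] (h : IsCliquePartition G A B) {k : ℕ}
    (hk : k + 2 = Fintype.card V) {f : Fin k → V}
    (hf : ∀ u v, G.Adj u v → (∃ g, f g = u) ∨ ∃ g, f g = v) :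
    Function.Injective f ∧ ∃ a ∈ A, ∃ b ∈ B, (∀ g, f g ≠ a) ∧ (∀ g, f g ≠ b) ∧
      ∀ v, v ≠ a → v ≠ b → ∃ g, f g = v := by
  classical
  have hun : ∀ u v, (∀ g, f g ≠ u) → (∀ g, f g ≠ v) → ¬ G.Adj u v := by
    intro u v hu hv huv
    rcases hf u v huv with ⟨g, hg⟩ | ⟨g, hg⟩
    exacts [hu g hg, hv g hg]
  have hcard : (Finset.univ.image f).card + (Finset.univ.image f)ᶜ.card = k + 2 := by
    rw [Finset.card_add_card_compl, hk]
  have hle : (Finset.univ.image f).card ≤ k := by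
    simpa using Finset.card_image_le (s := Finset.univ) (f := f)
  have hA : ((Finset.univ.image f)ᶜ.filter (· ∈ A)).card ≤ 1 := by
    rw [Finset.card_le_one]
    intro a ha b hb
    by_contra hab
    simp only [Finset.mem_filter, Finset.mem_compl, Finset.mem_image, Finset.mem_univ, true_and,
      not_exists] at ha hb
    exact hun a b ha.1 hb.1 (h.adj_left ha.2 hb.2 hab)
  have hB : ((Finset.univ.image f)ᶜ.filter (· ∉ A)).card ≤ 1 := by
    rw [Finset.card_le_one]
    intro a ha b hb
    by_contra hab
    simp only [Finset.mem_filter, Finset.mem_compl, Finset.mem_image, Finset.mem_univ, true_and,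
      not_exists] at ha hb
    exact hun a b ha.1 hb.1 (h.adj_right ((h.cover a).resolve_left ha.2)
      ((h.cover b).resolve_left hb.2) hab)
  have hsum := Finset.card_filter_add_card_filter_not (s := (Finset.univ.image f)ᶜ) (· ∈ A)
  -- At least two vertices are unoccupied, and at most one per clique. Equality holds throughout, so
  -- the image has k elements.
  have hinj : Function.Injective f := by
    rw [← Set.injOn_univ, ← Finset.coe_univ]
    refine Finset.card_image_iff.1 ?_
    simp only [Finset.card_univ, Fintype.card_fin]
    omega
  obtain ⟨a, ha⟩ := Finset.card_eq_one.1 (by omega :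
    ((Finset.univ.image f)ᶜ.filter (· ∈ A)).card = 1)
  obtain ⟨b, hb⟩ := Finset.card_eq_one.1 (by omega :
    ((Finset.univ.image f)ᶜ.filter (· ∉ A)).card = 1)
  have ha' : a ∈ (Finset.univ.image f)ᶜ.filter (· ∈ A) := ha ▸ Finset.mem_singleton_self a
  have hb' : b ∈ (Finset.univ.image f)ᶜ.filter (· ∉ A) := hb ▸ Finset.mem_singleton_self b
  simp only [Finset.mem_filter, Finset.mem_compl, Finset.mem_image, Finset.mem_univ, true_and,
    not_exists] at ha' hb'
  refine ⟨hinj, a, ha'.2, b, (h.cover b).resolve_left hb'.2, ha'.1, hb'.1, fun v hva hvb => ?_⟩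
  by_contra hv
  have hv' : v ∈ (Finset.univ.image f)ᶜ := by simpa using hv
  by_cases hvA : v ∈ A
  · exact hva (Finset.mem_singleton.1 (ha ▸ Finset.mem_filter.2 ⟨hv', hvA⟩))
  · exact hvb (Finset.mem_singleton.1 (hb ▸ Finset.mem_filter.2 ⟨hv', hvA⟩))

/-- A vertex that is never occupied under a winning strategy has no neighbour. -/
theorem not_adj_of_never_occupied {k : ℕ} {σ : List G.edgeSet → (Fin k → V)}
    (hσ : ∀ (h : List G.edgeSet) (e : G.edgeSet), Defends G (e : Sym2 V) (σ h) (σ (e :: h)))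
    {x : V} (hx : ∀ h g, σ h g ≠ x) (y : V) : ¬ G.Adj x y := by
  intro hxy
  obtain ⟨-, g, hg⟩ := hσ [] ⟨s(x, y), hxy⟩
  rcases Sym2.eq_iff.1 hg with ⟨h1, -⟩ | ⟨-, h1⟩
  exacts [hx _ g h1, hx _ g h1]

theorem IsCliquePartition.not_guardsWin_of_card_left_eq_one [Fintype V]
    (h : IsCliquePartition G A B) {k : ℕ} (hk : k + 2 = Fintype.card V) (hA : A.card = 1)
    {a b : V} (ha : a ∈ A) (hab : G.Adj a b) : ¬ GuardsWin G k := by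
  rintro ⟨σ, hσ⟩
  refine not_adj_of_never_occupied hσ (x := a) (fun l => ?_) b hab
  obtain ⟨-, a', ha', -, -, h1, -⟩ := h.exists_unoccupied hk
    (fun u v huv => (hσ l ⟨s(u, v), huv⟩).mem_range)
  rwa [Finset.card_le_one.1 hA.le a ha a' ha']

/-- The unoccupied vertex of B is not adjacent to the unoccupied vertex of A, hence is not global.
By uniqueness it is the same vertex at all times, yet it has a neighbour in B. -/
theorem IsCliquePartition.not_guardsWin_of_unique_not_global [Fintype V]
    (h : IsCliquePartition G A B) {k : ℕ} (hk : k + 2 = Fintype.card V) (hB : 2 ≤ B.card)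
    (hb : ∃! b, b ∈ B ∧ ¬ IsGlobal G b) : ¬ GuardsWin G k := by
  rintro ⟨σ, hσ⟩
  obtain ⟨b, ⟨hbB, hbg⟩, huniq⟩ := hb
  obtain ⟨c, hc, hcb⟩ := Finset.exists_mem_ne hB b
  refine not_adj_of_never_occupied hσ (x := b) (fun l => ?_) c (h.adj_right hbB hc hcb.symm)
  have hcov := fun u v huv => (hσ l ⟨s(u, v), huv⟩).mem_range
  obtain ⟨-, a', ha', b', hb', h1, h2, -⟩ := h.exists_unoccupied hk hcov
  rwa [← huniq b' ⟨hb', (h.not_global_right_iff hb').2 ⟨a', ha', fun hadj => ?_⟩⟩]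
  rcases hcov a' b' hadj with ⟨g, hg⟩ | ⟨g, hg⟩
  exacts [h1 g hg, h2 g hg]

/-- Let A = {a, c} with c isolated from B. If a is unoccupied, an attack on an edge ab brings a
guard from b to a, while the guard on c has nowhere else to go; then all of A is occupied. An
unoccupied a can be forced. -/
theorem IsCliquePartition.not_guardsWin_of_unique_attached [Fintype V]
    (h : IsCliquePartition G A B) {k : ℕ} (hk : k + 2 = Fintype.card V) (hA : A.card = 2)
    (ha : ∃! a, a ∈ A ∧ ∃ b ∈ B, G.Adj a b) : ¬ GuardsWin G k := by
  classical
  rintro ⟨σ, hσ⟩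
  obtain ⟨a, ⟨haA, b, hb, hab⟩, huniq⟩ := ha
  obtain ⟨c, hc, hca⟩ := Finset.exists_mem_ne hA.ge a
  have hA' : ∀ x ∈ A, x = a ∨ x = c := by
    intro x hx
    by_contra! hcon
    have : ({x, a, c} : Finset V) ⊆ A := by
      intro y; simp only [Finset.mem_insert, Finset.mem_singleton]; grind
    have := Finset.card_le_card this
    rw [Finset.card_eq_three.2 ⟨x, a, c, hcon.1, hcon.2, hca.symm, rfl⟩] at this
    omega
  have hcB : ∀ y ∈ B, ¬ G.Adj c y := fun y hy hcy => hca (huniq c ⟨hc, y, hy, hcy⟩)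
  have hconf := fun l => h.exists_unoccupied hk
    (fun u v huv => (hσ l ⟨s(u, v), huv⟩).mem_range)
  have main : ∀ l, ¬ ∀ g, σ l g ≠ a := by
    intro l hl
    obtain ⟨-, a', ha', b', hb', h1, h2, h3⟩ := hconf l
    have hca' : c ≠ a' := by
      rintro rfl
      obtain ⟨g, hg⟩ := h3 a hca.symm (fun e => h.notMem_right haA (e ▸ hb'))
      exact hl g hg
    obtain ⟨g, hg⟩ := h3 c hca' (fun e => h.notMem_right hc (e ▸ hb'))
    obtain ⟨hmove, g', hg'⟩ := hσ l ⟨s(a, b), hab⟩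
    obtain ⟨hinj, a'', ha'', b'', hb'', h1', h2', h3'⟩ := hconf (⟨s(a, b), hab⟩ :: l)
    rcases Sym2.eq_iff.1 hg' with ⟨e1, -⟩ | ⟨e1, e2⟩
    · exact hl g' e1
    · have hgg : g ≠ g' := by
        rintro rfl
        exact h.notMem_right hc (hg ▸ e1 ▸ hb)
      -- This guard has no neighbour in B, and a is taken by another guard, so by injectivity it
      -- stays.
      have hgc : σ (⟨s(a, b), hab⟩ :: l) g = c := by
        rcases hmove g with e | e
        · rw [e, hg]
        · rw [hg] at e
          rcases h.cover (σ (⟨s(a, b), hab⟩ :: l) g) with hm | hm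
          · rcases hA' _ hm with e' | e'
            · exact absurd (hinj (e'.trans e2.symm)) hgg
            · exact e'
          · exact absurd e (hcB _ hm)
      rcases hA' a'' ha'' with rfl | rfl
      · exact h1' _ e2
      · exact h1' _ hgc
  have hac : G.Adj a c := h.adj_left haA hc hca.symm
  obtain ⟨-, a', ha', b', hb', h1, h2, h3⟩ := hconf []
  rcases hA' a' ha' with rfl | rfl
  · exact main _ h1
  -- Here c is the vacancy of A. Attacking the edge inside A pulls the guard from a to c and vacates
  -- a.
  · obtain ⟨-, g', hg'⟩ := hσ [] ⟨s(a, a'), hac⟩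
    obtain ⟨-, a'', ha'', b'', hb'', h1', h2', h3'⟩ := hconf [⟨s(a, a'), hac⟩]
    rcases Sym2.eq_iff.1 hg' with ⟨-, e1⟩ | ⟨e1, -⟩
    · rcases hA' a'' ha'' with rfl | rfl
      · exact main _ h1'
      · exact h1' _ e1
    · exact h1 _ e1

end Cobipartite
end EVC

namespace EVC

/-! ### Which value is attained, and a form free of the partition -/

section Normalized

variable {V : Type u} {G : SimpleGraph V} {A B : Finset V}

theorem IsNormalizedPartition.exists_not_adj (h : IsNormalizedPartition G A B) {a : V}
    (ha : a ∈ A) : ∃ b ∈ B, ¬ G.Adj a b :=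
  h.exists_not_adj_of_left ha (h.not_global a ha)

/-- The case distinction is on the shape of the set of cross edges: a star centred in A, a star
centred in B, or neither. The excluded configurations are what make the cliques large enough for the
star strategies. -/
theorem IsNormalizedPartition.guardsWin [Fintype V] (h : IsNormalizedPartition G A B)
    (hA : 2 ≤ A.card) (h2 : A.card = 2 → ¬ ∃! a, a ∈ A ∧ ∃ b ∈ B, G.Adj a b)
    (hB : ¬ ∃! b, b ∈ B ∧ ¬ IsGlobal G b) : GuardsWin G (Fintype.card V - 2) := by
  classical
  have hP := h.toIsCliquePartition
  have hAB := h.card_le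
  by_cases hsA : ∃ c ∈ A, ∃ d ∈ B, G.Adj c d ∧ ∀ a ∈ A, ∀ b ∈ B, G.Adj a b → a = c
  · obtain ⟨c, hc, d, hd, hcd, hst⟩ := hsA
    have hA3 : A.card ≠ 2 := fun hA2 =>
      h2 hA2 ⟨c, ⟨hc, d, hd, hcd⟩, fun a ⟨ha, b, hb, hab⟩ => hst a ha b hb hab⟩
    by_cases hd' : ∃ d' ∈ B, d ≠ d' ∧ G.Adj c d'
    · obtain ⟨d', hd', hne, hcd'⟩ := hd'
      exact hP.guardsWin_of_star (by omega) hc hd hd' hne hcd hcd' hst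
    · push Not at hd'
      refine hP.guardsWin_of_single_edge (by omega) (by omega) hc hd fun a ha b hb hab => ?_
      obtain rfl := hst a ha b hb hab
      refine ⟨rfl, by_contra fun hbd => hd' b hb (Ne.symm hbd) hab⟩
  by_cases hsB : ∃ d ∈ B, ∃ c ∈ A, G.Adj c d ∧ ∀ a ∈ A, ∀ b ∈ B, G.Adj a b → b = d
  · obtain ⟨d, hd, c, hc, hcd, hst⟩ := hsB
    obtain ⟨c', hc', hne, hcd'⟩ : ∃ c' ∈ A, c ≠ c' ∧ G.Adj c' d := by
      by_contra! hcon
      refine hsA ⟨c, hc, d, hd, hcd, fun a ha b hb hab => ?_⟩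
      obtain rfl := hst a ha b hb hab
      exact by_contra fun hac => hcon a ha (Ne.symm hac) hab
    by_cases hB3 : 3 ≤ B.card
    · exact hP.symm.guardsWin_of_star hB3 hd hc hc' hne hcd.symm hcd'.symm
        fun b hb a ha hab => hst a ha b hb hab.symm
    -- Now p = q = 2 and d is joined to all of A, hence global. The other vertex of B is then the
    -- unique non-global one.
    · exfalso
      have hA2 : A = {c, c'} :=
        (Finset.eq_of_subset_of_card_le (by simp [Finset.insert_subset_iff, hc, hc'])
          (by rw [Finset.card_pair hne]; omega)).symm
      obtain ⟨e, he, hed⟩ := Finset.exists_mem_ne (by omega : 1 < B.card) d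
      refine hB ⟨e, ⟨he, (hP.not_global_right_iff he).2 ⟨c, hc, fun hce =>
        hed (hst c hc e he hce)⟩⟩, ?_⟩
      rintro y ⟨hy, hyg⟩
      obtain ⟨a, ha, hay⟩ := (hP.not_global_right_iff hy).1 hyg
      by_contra hye
      have : ({d, e, y} : Finset V) ⊆ B := by
        intro z; simp only [Finset.mem_insert, Finset.mem_singleton]; grind
      have hyd : y ≠ d := by
        rintro rfl
        rw [hA2, Finset.mem_insert, Finset.mem_singleton] at ha
        rcases ha with rfl | rfl <;> contradiction
      have := Finset.card_le_card this
      rw [Finset.card_eq_three.2 ⟨d, e, y, hed.symm, hyd.symm, Ne.symm hye, rfl⟩] at this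
      omega
  refine hP.guardsWin_of_not_star (fun a ha => h.exists_not_adj ha) ?_ ?_ ?_
  · obtain ⟨a, ha⟩ := Finset.card_pos.1 (by omega : 0 < A.card)
    obtain ⟨b, hb, hab⟩ := h.exists_not_adj ha
    by_contra! hcon
    refine hB ⟨b, ⟨hb, (hP.not_global_right_iff hb).2 ⟨a, ha, hab⟩⟩, ?_⟩
    rintro y ⟨hy, hyg⟩
    obtain ⟨a', ha', hay⟩ := (hP.not_global_right_iff hy).1 hyg
    by_contra hyb
    exact hay (hcon b hb y hy (Ne.symm hyb) ⟨a, ha, hab⟩ a' ha')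
  · intro a ha b hb hab
    by_contra! hcon
    exact hsA ⟨a, ha, b, hb, hab, fun a' ha' b' hb' h' =>
      by_contra fun hne => hcon a' ha' b' hb' hne h'⟩
  · intro a ha b hb hab
    by_contra! hcon
    exact hsB ⟨b, hb, a, ha, hab, fun a' ha' b' hb' h' =>
      by_contra fun hne => hcon a' ha' b' hb' hne h'⟩

theorem IsNormalizedPartition.evc_eq_iff_of_two_le [Fintype V]
    (h : IsNormalizedPartition G A B) (hA : 2 ≤ A.card) :
    evc G + 1 = A.card + B.card ↔
      (A.card = 2 ∧ ∃! a, a ∈ A ∧ ∃ b ∈ B, G.Adj a b) ∨ ∃! b, b ∈ B ∧ ¬ IsGlobal G b := by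
  have hP := h.toIsCliquePartition
  have hcard := hP.card_add_card
  have hAB := h.card_le
  constructor
  · intro hev
    by_contra! hcon
    have := evc_le (h.guardsWin hA (fun h2 hu => hcon.1 h2 hu) hcon.2)
    omega
  · intro hor
    have : Nonempty V := by
      obtain ⟨a, -⟩ := Finset.card_pos.1 (by omega : 0 < A.card)
      exact ⟨a⟩
    refine hP.evc_eq.resolve_left fun hev => ?_
    rcases hor with ⟨h2, hu⟩ | hu
    · exact hP.not_guardsWin_of_unique_attached (by omega) h2 hu (guardsWin_evc G)
    · exact hP.not_guardsWin_of_unique_not_global (by omega) (by omega) hu (guardsWin_evc G)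

theorem IsCliquePartition.evc_eq_of_card_left_eq_zero [Fintype V] [Nonempty V]
    (h : IsCliquePartition G A B) (hA : A.card = 0) : evc G + 1 = A.card + B.card := by
  classical
  refine h.evc_eq.resolve_left fun hev => ?_
  obtain ⟨σ, hσ⟩ := guardsWin_evc G
  have := card_le_of_occupies_clique B h.clique_right (f := σ [])
    fun u v huv => (hσ [] ⟨s(u, v), huv⟩).mem_range
  have h' := Finset.card_le_univ (Finset.univ.filter fun g => σ [] g ∈ B)
  rw [Fintype.card_fin] at h'
  omega

/-- Without cross edges the vertex of A is isolated and may stay empty forever, while the vacancy in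
B follows the attacks. -/
theorem IsNormalizedPartition.evc_eq_iff_of_card_left_eq_one [Fintype V] [Nonempty V]
    (h : IsNormalizedPartition G A B) (hA : A.card = 1) :
    evc G + 2 = A.card + B.card ↔ ∀ a ∈ A, ∀ b ∈ B, ¬ G.Adj a b := by
  have hP := h.toIsCliquePartition
  have hcard := hP.card_add_card
  constructor
  · intro hev a ha b hb hab
    exact hP.not_guardsWin_of_card_left_eq_one (by omega) hA ha hab (guardsWin_evc G)
  · intro hno
    refine hP.evc_eq.resolve_right fun hev => ?_
    have hirr : ∀ v, ¬ G.Adj v v := fun v => G.irrefl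
    suffices GuardsWin G (Fintype.card V - 2) by
      have := evc_le this
      have := h.card_le
      omega
    refine guardsWin_of_responds (fun a b => a ∈ A ∧ b ∈ B) ?_ ?_ ?_ ?_ ?_
    · obtain ⟨a, ha⟩ := Finset.card_pos.1 (by omega : 0 < A.card)
      obtain ⟨b, hb, -⟩ := h.exists_not_adj ha
      exact ⟨a, b, ha, hb⟩
    · rintro a b ⟨ha, hb⟩ rfl
      exact hP.notMem_right ha hb
    · exact fun a b h => hno a h.1 b h.2
    · rintro a b ⟨ha, hb⟩ u hu
      rcases hP.cover u with hu' | hu'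
      · exact absurd hu (Finset.card_le_one.1 hA.le a ha u hu' ▸ hirr _)
      · exact absurd hu.symm (hno a ha u hu')
    · rintro a b ⟨ha, hb⟩ u hu
      rcases hP.cover u with hu' | hu'
      · exact absurd hu (hno u hu' b hb)
      · exact ⟨u, a, a, by grind [hP.notMem_right ha]⟩

theorem IsNormalizedPartition.matching_iff [Fintype V] (h : IsNormalizedPartition G A B)
    (hA : A.card = 2) (hB : B.card = 2) :
    ¬ ((∃! a, a ∈ A ∧ ∃ b ∈ B, G.Adj a b) ∨ ∃! b, b ∈ B ∧ ¬ IsGlobal G b) ↔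
      (∀ a ∈ A, ∀ b ∈ B, ¬ G.Adj a b) ∨
        ((∀ a ∈ A, ∃! b, b ∈ B ∧ G.Adj a b) ∧ (∀ b ∈ B, ∃! a, a ∈ A ∧ G.Adj a b)) := by
  classical
  have hP := h.toIsCliquePartition
  have hg : (∃! b, b ∈ B ∧ ¬ IsGlobal G b) ↔ ∃! b, b ∈ B ∧ ∃ a ∈ A, ¬ G.Adj a b :=
    existsUnique_congr fun b => and_congr_right fun hb => hP.not_global_right_iff hb
  rw [hg]
  have hna := fun a ha => h.exists_not_adj (a := a) ha
  obtain ⟨a₁, a₂, ha, rfl⟩ := Finset.card_eq_two.1 hA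
  obtain ⟨b₁, b₂, hb, rfl⟩ := Finset.card_eq_two.1 hB
  simp only [Finset.mem_insert, Finset.mem_singleton, forall_eq_or_imp, forall_eq,
    exists_eq_or_imp, exists_eq_left, ExistsUnique] at hna ⊢
  -- There are sixteen patterns of cross edges; `hna` discards those in which a vertex of A is
  -- global.
  by_cases h11 : G.Adj a₁ b₁ <;> by_cases h12 : G.Adj a₁ b₂ <;> by_cases h21 : G.Adj a₂ b₁ <;>
    by_cases h22 : G.Adj a₂ b₂ <;> simp_all

/-- Global vertices can be put into either clique. Remove them from both colour classes, let A be
the smaller remainder, and put everything else into B. -/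
theorem exists_isNormalizedPartition [Fintype V] (hG : IsCobipartite G) :
    ∃ A B : Finset V, IsNormalizedPartition G A B := by
  classical
  obtain ⟨c⟩ := hG
  have hc : ∀ v w, c v = c w → v ≠ w → G.Adj v w := by
    intro v w hvw hne
    by_contra hadj
    exact c.valid ((SimpleGraph.compl_adj _ _ _).2 ⟨hne, hadj⟩) hvw
  have h2 : ∀ i j : Fin 2, i ≠ j → ∀ v, c v = i ∨ c v = j := by
    intro i j hij v
    generalize c v = x
    revert i j x
    decide
  have key : ∀ i j : Fin 2, i ≠ j →
      (Finset.univ.filter fun v => c v = i ∧ ¬ IsGlobal G v).card ≤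
        (Finset.univ.filter fun v => c v = j ∧ ¬ IsGlobal G v).card →
      ∃ A B : Finset V, IsNormalizedPartition G A B := by
    intro i j hij hle
    refine ⟨Finset.univ.filter fun v => c v = i ∧ ¬ IsGlobal G v,
      Finset.univ.filter fun v => c v = j ∨ IsGlobal G v, ⟨⟨?_, ?_, ?_, ?_⟩, ?_, ?_⟩⟩
    · rw [Finset.disjoint_filter]
      rintro v - ⟨h1, h2⟩ (h3 | h3)
      exacts [hij (h1.symm.trans h3), h2 h3]
    · intro v
      have := h2 i j hij v
      simp only [Finset.mem_filter, Finset.mem_univ, true_and]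
      tauto
    · intro v hv w hw hne
      simp only [Finset.coe_filter, Finset.mem_univ, true_and, Set.mem_ofPred_eq] at hv hw
      exact hc v w (hv.1.trans hw.1.symm) hne
    · intro v hv w hw hne
      simp only [Finset.coe_filter, Finset.mem_univ, true_and, Set.mem_ofPred_eq] at hv hw
      rcases hv with hv | hv
      · rcases hw with hw | hw
        · exact hc v w (hv.trans hw.symm) hne
        · exact (hw v hne).symm
      · exact hv w hne.symm
    · refine hle.trans (Finset.card_le_card fun v => ?_)
      simp only [Finset.mem_filter, Finset.mem_univ, true_and]
      tauto
    · intro a ha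
      simp only [Finset.mem_filter, Finset.mem_univ, true_and] at ha
      exact ha.2
  rcases le_total (Finset.univ.filter fun v => c v = 0 ∧ ¬ IsGlobal G v).card
    (Finset.univ.filter fun v => c v = 1 ∧ ¬ IsGlobal G v).card with hle | hle
  · exact key 0 1 (by decide) hle
  · exact key 1 0 (by decide) hle

/-! ### A characterization that does not mention the partition -/

/-- All non-adjacent pairs contain one common vertex, and some vertex is global. -/
def CoStar (G : SimpleGraph V) : Prop :=
  (∃ c, ∀ u v, u ≠ v → ¬ G.Adj u v → u = c ∨ v = c) ∧ ∃ g, IsGlobal G g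

/-- Some pendant vertex hangs at a vertex that has a further neighbour but is not global. -/
def HasPendant (G : SimpleGraph V) : Prop :=
  ∃ x y, (∀ v, G.Adj x v ↔ v = y) ∧ (∃ v, v ≠ x ∧ G.Adj y v) ∧ ¬ IsGlobal G y

/-- `CoStar` covers p = 0, p = 1 with a cross edge, and a unique non-global vertex of B when p ≥ 2.
`HasPendant` covers p = 2 with a single attached vertex of A: the other vertex of A is pendant. -/
theorem IsNormalizedPartition.evc_eq_iff [Fintype V] [Nonempty V]
    (h : IsNormalizedPartition G A B) :
    evc G + 1 = Fintype.card V ↔ CoStar G ∨ HasPendant G := by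
  classical
  have hP := h.toIsCliquePartition
  have hAB := h.card_le
  rw [← hP.card_add_card]
  have hcov := hP.cover
  have hdis : ∀ v, v ∈ A → v ∉ B := fun v => hP.notMem_right
  have hcA : ∀ v w, v ∈ A → w ∈ A → v ≠ w → G.Adj v w := fun v w => hP.adj_left
  have hcB : ∀ v w, v ∈ B → w ∈ B → v ≠ w → G.Adj v w := fun v w => hP.adj_right
  have hs : ∀ v w, G.Adj v w → G.Adj w v := fun v w e => e.symm
  have hirr : ∀ v, ¬ G.Adj v v := fun v => G.irrefl
  have hnaA : ∀ a ∈ A, ∃ b ∈ B, ¬ G.Adj a b := fun a ha => h.exists_not_adj ha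
  have hgB : ∀ g, IsGlobal G g → g ∈ B := fun g hg =>
    (hcov g).resolve_left fun hgA => h.not_global g hgA hg
  obtain h0 | h1 | h2 : A.card = 0 ∨ A.card = 1 ∨ 2 ≤ A.card := by omega
  · have hall : ∀ v, v ∈ B := fun v => (hcov v).resolve_left (by simp [Finset.card_eq_zero.1 h0])
    simp only [hP.evc_eq_of_card_left_eq_zero h0, true_iff]
    obtain ⟨v⟩ := ‹Nonempty V›
    refine Or.inl ⟨⟨v, fun u w huw hn => absurd (hcB u w (hall u) (hall w) huw) hn⟩, v,
      fun w hw => hcB v w (hall v) (hall w) hw.symm⟩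
  · have hiff := h.evc_eq_iff_of_card_left_eq_one h1
    have hor := hP.evc_eq
    obtain ⟨a, rfl⟩ := Finset.card_eq_one.1 h1
    have : evc G + 1 = Finset.card {a} + B.card ↔ ∃ b ∈ B, G.Adj a b := by
      simp only [Finset.mem_singleton, forall_eq] at hiff
      constructor
      · intro he
        by_contra! hcon
        have := hiff.2 hcon
        omega
      · rintro ⟨b, hb, hab⟩
        exact hor.resolve_left fun he => hiff.1 he b hb hab
    rw [this]
    simp only [Finset.mem_singleton] at *
    constructor
    · rintro ⟨b, hb, hab⟩
      refine Or.inl ⟨⟨a, by grind⟩, b, fun w hw => by grind⟩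
    · rintro (⟨-, g, hg⟩ | ⟨x, y, hx, ⟨v, hvx, hyv⟩, hy⟩)
      · exact ⟨g, hgB g hg, (hg a (by rintro rfl; exact hdis _ rfl (hgB _ hg))).symm⟩
      · by_contra! hcon
        have h1 := hx v
        have h2 := hx y
        grind
  · rw [h.evc_eq_iff_of_two_le h2]
    have hB2 : 1 < B.card := by omega
    constructor
    · rintro (⟨hA2, a, ⟨ha, b, hb, hab⟩, huniq⟩ | ⟨b, ⟨hb, hbg⟩, huniq⟩)
      · right
        obtain ⟨c, hc, hca⟩ := Finset.exists_mem_ne (by omega : 1 < A.card) a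
        have hA' : A = {a, c} :=
          (Finset.eq_of_subset_of_card_le (by simp [Finset.insert_subset_iff, ha, hc])
            (by rw [Finset.card_pair hca.symm]; omega)).symm
        refine ⟨c, a, fun v => ?_, ⟨b, by grind, hab⟩, h.not_global a ha⟩
        have := huniq c
        grind
      · left
        refine ⟨⟨b, fun u v huv hn => ?_⟩, ?_⟩
        · have h1 := fun u v (hu : u ∈ A) (hv : v ∈ B) (hn : ¬ G.Adj u v) =>
            huniq v ⟨hv, (hP.not_global_right_iff hv).2 ⟨u, hu, hn⟩⟩
          grind
        · obtain ⟨c, hc, hcb⟩ := Finset.exists_mem_ne hB2 b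
          exact ⟨c, by_contra fun hcg => hcb (huniq c ⟨hc, hcg⟩)⟩
    · rintro (⟨⟨c, hc⟩, g, hg⟩ | ⟨x, y, hx, ⟨v, hvx, hyv⟩, hy⟩)
      · right
        -- A vertex of A other than the centre still has a non-neighbour in B, which must be the
        -- centre. So the centre lies in B.
        obtain ⟨a, ha, hac⟩ := Finset.exists_mem_ne (by omega : 1 < A.card) c
        obtain ⟨b, hb, hab⟩ := hnaA a ha
        obtain rfl : b = c := by
          rcases hc a b (by rintro rfl; exact hdis _ ha hb) hab with e | e
          exacts [absurd e hac, e]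
        refine ⟨b, ⟨hb, (hP.not_global_right_iff hb).2 ⟨a, ha, hab⟩⟩, ?_⟩
        rintro y ⟨hy, hyg⟩
        obtain ⟨a', ha', hay⟩ := (hP.not_global_right_iff hy).1 hyg
        refine (hc a' y ?_ hay).resolve_left ?_
        · rintro rfl; exact hdis _ ha' hy
        · rintro rfl; exact hdis _ ha' hb
      · left
        -- A clique containing the pendant vertex x has no vertices besides x and y.
        have hsmall : ∀ C : Finset V, (∀ v w, v ∈ C → w ∈ C → v ≠ w → G.Adj v w) → x ∈ C →
            2 ≤ C.card → C = {x, y} := by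
          intro C hC hxC hC2
          obtain ⟨z, hz, hzx⟩ := Finset.exists_mem_ne (by omega : 1 < C.card) x
          ext w
          have := hC x z hxC hz hzx.symm
          have := hC x w hxC
          grind
        rcases hcov x with hxA | hxB
        · have hA' := hsmall A hcA hxA h2
          have hxy : x ≠ y := by rintro rfl; exact hirr x ((hx x).2 rfl)
          refine ⟨by rw [hA', Finset.card_pair hxy], y, ⟨by simp [hA'], v, ?_, hyv⟩, ?_⟩
          · grind
          · rintro w ⟨hw, b, hb, hwb⟩
            grind
        · have hB' := hsmall B hcB hxB (by omega)
          have hxy : x ≠ y := by rintro rfl; exact hirr x ((hx x).2 rfl)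
          -- If the pendant vertex lies in B, then p = q = 2, and v is the only vertex of A attached
          -- to B.
          have hBc : B.card = 2 := by rw [hB', Finset.card_pair hxy]
          refine ⟨by omega, v, ⟨by grind, y, by simp [hB'], hyv.symm⟩, ?_⟩
          rintro w ⟨hw, b, hb, hwb⟩
          obtain ⟨a, ha, hay⟩ := (hP.not_global_right_iff (by simp [hB'] : y ∈ B)).1 hy
          have hvA : v ∈ A := by grind
          have hA' : A = {v, a} :=
            (Finset.eq_of_subset_of_card_le (by simp [Finset.insert_subset_iff, ha, hvA])
              (by rw [Finset.card_pair (by rintro rfl; exact hay hyv.symm)]; omega)).symm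
          grind

end Normalized
end EVC

namespace EVC

/-! ### Reduction to counting zeros of the adjacency matrix -/

section Counting

theorem IsCobipartite.not_triangle {V : Type u} {G : SimpleGraph V}
    (hG : IsCobipartite G) {x u v : V} (h1 : Gᶜ.Adj x u)
    (h2 : Gᶜ.Adj u v) (h3 : Gᶜ.Adj x v) : False := by
  obtain ⟨c⟩ := hG
  have e1 := c.valid h1
  have e2 := c.valid h2
  have e3 := c.valid h3
  generalize c x = i at *
  generalize c u = j at *
  generalize c v = k at *
  revert i j k
  decide

variable {V : Type u} [Fintype V] [DecidableEq V] {G : SimpleGraph V} [DecidableRel G.Adj]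

theorem not_isGlobal_iff {v : V} : ¬ IsGlobal G v ↔ 0 < Gᶜ.degree v := by
  rw [SimpleGraph.degree_pos_iff_exists_adj]
  simp [IsGlobal, SimpleGraph.compl_adj, eq_comm]

/-- All edges of the complement meet in one vertex iff its maximum degree equals its number of
edges. The centre and its neighbours then number one more than the edges, and a global vertex of the
graph is any vertex left over. -/
theorem coStar_iff (hV : 2 ≤ Fintype.card V) :
    CoStar G ↔ Gᶜ.edgeFinset.card + 2 ≤ Fintype.card V ∧ Gᶜ.maxDegree = Gᶜ.edgeFinset.card := by
  have : Nonempty V := Fintype.card_pos_iff.1 (by omega)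
  have hdeg : ∀ v, Gᶜ.degree v ≤ Gᶜ.edgeFinset.card := fun v => by
    rw [← SimpleGraph.card_incidenceFinset_eq_degree]
    exact Finset.card_le_card (SimpleGraph.incidenceFinset_subset _ v)
  constructor
  · rintro ⟨⟨c, hc⟩, g, hg⟩
    have hle : Gᶜ.edgeFinset.card ≤ Gᶜ.degree c := by
      rw [← SimpleGraph.card_incidenceFinset_eq_degree]
      refine Finset.card_le_card fun e he => ?_
      induction e with | _ u v
      rw [SimpleGraph.mem_edgeFinset, SimpleGraph.mem_edgeSet, SimpleGraph.compl_adj] at he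
      rw [SimpleGraph.mem_incidenceFinset, SimpleGraph.mk'_mem_incidenceSet_iff]
      exact ⟨(SimpleGraph.compl_adj _ _ _).2 he, (hc u v he.1 he.2).imp Eq.symm Eq.symm⟩
    have hmax := Gᶜ.degree_le_maxDegree c
    obtain ⟨m, hm⟩ := Gᶜ.exists_maximal_degree_vertex
    have := hdeg m
    have hdc : Gᶜ.degree c + 2 ≤ Fintype.card V := by
      by_cases hcg : c = g
      · have : Gᶜ.degree c = 0 := by
          by_contra h0
          exact not_isGlobal_iff.2 (Nat.pos_of_ne_zero h0) (hcg ▸ hg)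
        omega
      · have hsub : insert c (insert g (Gᶜ.neighborFinset c)) ⊆ Finset.univ :=
          Finset.subset_univ _
        have := Finset.card_le_card hsub
        rw [Finset.card_insert_of_notMem, Finset.card_insert_of_notMem,
          SimpleGraph.card_neighborFinset_eq_degree] at this
        · rw [Finset.card_univ] at this
          omega
        · rw [SimpleGraph.mem_neighborFinset, SimpleGraph.compl_adj]
          exact fun h => h.2 (hg c hcg).symm
        · simp [hcg]
    omega
  · rintro ⟨hE, hmax⟩
    obtain ⟨c, hc⟩ := Gᶜ.exists_maximal_degree_vertex
    have hinc : Gᶜ.incidenceFinset c = Gᶜ.edgeFinset :=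
      Finset.eq_of_subset_of_card_le (SimpleGraph.incidenceFinset_subset _ c)
        (by rw [SimpleGraph.card_incidenceFinset_eq_degree]; omega)
    have hall : ∀ u v, u ≠ v → ¬ G.Adj u v → u = c ∨ v = c := by
      intro u v huv hn
      have : s(u, v) ∈ Gᶜ.incidenceFinset c := by
        rw [hinc, SimpleGraph.mem_edgeFinset, SimpleGraph.mem_edgeSet, SimpleGraph.compl_adj]
        exact ⟨huv, hn⟩
      rw [SimpleGraph.mem_incidenceFinset, SimpleGraph.mk'_mem_incidenceSet_iff] at this
      exact this.2.imp Eq.symm Eq.symm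
    refine ⟨⟨c, hall⟩, ?_⟩
    have hlt : (insert c (Gᶜ.neighborFinset c)).card < Fintype.card V := by
      refine (Finset.card_insert_le _ _).trans_lt ?_
      rw [SimpleGraph.card_neighborFinset_eq_degree]
      omega
    obtain ⟨g, -, hg⟩ := Finset.exists_mem_notMem_of_card_lt_card
      (s := insert c (Gᶜ.neighborFinset c)) (t := Finset.univ) (by rwa [Finset.card_univ])
    simp only [Finset.mem_insert, SimpleGraph.mem_neighborFinset, SimpleGraph.compl_adj,
      not_or, not_and, not_not] at hg
    refine ⟨g, fun w hw => by_contra fun hn => ?_⟩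
    rcases hall g w hw.symm hn with h | h
    · exact hg.1 h
    · exact hn (h ▸ (hg.2 (Ne.symm hg.1)).symm)

/-- If `y` is the only neighbour of `x`, then every edge of the complement meets `x` or `y`. -/
theorem IsCobipartite.card_edgeFinset_compl (hG : IsCobipartite G) {x y : V}
    (hx : ∀ v, G.Adj x v ↔ v = y) :
    Gᶜ.edgeFinset.card = Gᶜ.degree x + Gᶜ.degree y := by
  have hxy : G.Adj x y := (hx y).2 rfl
  rw [← SimpleGraph.card_incidenceFinset_eq_degree, ← SimpleGraph.card_incidenceFinset_eq_degree,
    ← Finset.card_union_of_disjoint]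
  · congr 1
    ext e
    induction e with | _ u v
    simp only [Finset.mem_union, SimpleGraph.mem_edgeFinset, SimpleGraph.mem_edgeSet,
      SimpleGraph.mem_incidenceFinset, SimpleGraph.mk'_mem_incidenceSet_iff]
    rw [← and_or_left, iff_self_and]
    intro huv
    by_contra! hcon
    have hxa : ∀ w, x ≠ w → y ≠ w → Gᶜ.Adj x w := fun w h1 h2 => by
      rw [SimpleGraph.compl_adj, hx]
      exact ⟨h1, h2.symm⟩
    -- A complement edge avoiding x and y would form a triangle with x.
    exact hG.not_triangle (hxa u hcon.1.1 hcon.2.1) huv (hxa v hcon.1.2 hcon.2.2)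
  · rw [Finset.disjoint_left]
    intro e
    induction e with | _ u v
    simp only [SimpleGraph.mem_incidenceFinset, SimpleGraph.mk'_mem_incidenceSet_iff,
      SimpleGraph.compl_adj]
    rintro ⟨⟨h1, h2⟩, h3⟩ ⟨-, h4⟩
    have := hxy.ne
    have := hxy.symm
    grind

/-- A pendant vertex has complement degree n - 2. The complement has n - 2 plus the complement
degree of y edges, so the bounds on the edge count say that this degree lies between 1 and n - 3: y
is not global and has a second neighbour. -/
theorem IsCobipartite.hasPendant_iff (hG : IsCobipartite G) (hV : 2 ≤ Fintype.card V) :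
    HasPendant G ↔ Gᶜ.maxDegree + 2 = Fintype.card V ∧
      Fintype.card V ≤ Gᶜ.edgeFinset.card + 1 ∧
      Gᶜ.edgeFinset.card + 5 ≤ 2 * Fintype.card V := by
  have : Nonempty V := Fintype.card_pos_iff.1 (by omega)
  have hlt : ∀ v, G.degree v < Fintype.card V := fun v => G.degree_lt_card_verts v
  have hcompl : ∀ v, Gᶜ.degree v = Fintype.card V - 1 - G.degree v := fun v => G.degree_compl v
  constructor
  · rintro ⟨x, y, hx, ⟨v, hvx, hyv⟩, hy⟩
    have hxy : G.Adj x y := (hx y).2 rfl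
    have hE := hG.card_edgeFinset_compl hx
    have hx1 : G.degree x = 1 := SimpleGraph.degree_eq_one_iff_existsUnique_adj.2
      ⟨y, hxy, fun w hw => (hx w).1 hw⟩
    have hy1 := not_isGlobal_iff.1 hy
    have hy2 : 2 ≤ G.degree y := by
      rw [← SimpleGraph.card_neighborFinset_eq_degree, ← Finset.card_pair hvx]
      refine Finset.card_le_card ?_
      simp [Finset.insert_subset_iff, hyv, hxy.symm]
    have h1 := hcompl x
    have h2 := hcompl y
    have h3 := hlt y
    have hmax := Gᶜ.degree_le_maxDegree x
    obtain ⟨m, hm⟩ := Gᶜ.exists_maximal_degree_vertex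
    have hm1 := hcompl m
    -- A vertex isolated in the graph would form a triangle of the complement with x and v.
    have hmle : Gᶜ.degree m + 2 ≤ Fintype.card V := by
      by_contra hcon
      have hm0 : G.degree m = 0 := by omega
      have hma : ∀ w, m ≠ w → Gᶜ.Adj m w := fun w hw => by
        rw [SimpleGraph.compl_adj]
        refine ⟨hw, fun hmw => ?_⟩
        have := (SimpleGraph.degree_pos_iff_exists_adj (G := G) m).2 ⟨w, hmw⟩
        omega
      have hxa : ∀ w, x ≠ w → y ≠ w → Gᶜ.Adj x w := fun w h1 h2 => by
        rw [SimpleGraph.compl_adj, hx]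
        exact ⟨h1, h2.symm⟩
      have hmx : m ≠ x := by rintro rfl; omega
      have hmy : m ≠ y := by rintro rfl; omega
      have hmv : m ≠ v := by
        rintro rfl
        exact ((SimpleGraph.compl_adj _ _ _).1 (hma y hmy)).2 hyv.symm
      exact hG.not_triangle (hxa m hmx.symm hmy.symm) (hma v hmv) (hxa v hvx.symm hyv.ne)
    omega
  · rintro ⟨hmax, hE1, hE2⟩
    obtain ⟨x, hxm⟩ := Gᶜ.exists_maximal_degree_vertex
    have h1 := hcompl x
    have h2 := hlt x
    obtain ⟨y, hxy, huniq⟩ := SimpleGraph.degree_eq_one_iff_existsUnique_adj.1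
      (by omega : G.degree x = 1)
    have hx : ∀ v, G.Adj x v ↔ v = y := fun v => ⟨fun h => huniq v h, fun h => h ▸ hxy⟩
    have hE := hG.card_edgeFinset_compl hx
    have h3 := hcompl y
    refine ⟨x, y, hx, ?_, not_isGlobal_iff.2 (by omega)⟩
    obtain ⟨v, hv, hvx⟩ := Finset.exists_mem_ne
      (by rw [SimpleGraph.card_neighborFinset_eq_degree]; omega :
        1 < (G.neighborFinset y).card) x
    exact ⟨v, hvx, by simpa using hv⟩

/-- The test, in terms of the number `n` of vertices, the number `z` of zeros of the adjacency
matrix, and the largest number `d` of zeros in a row, that `evc G = n - 1`. -/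
def CountTest (n z d : ℤ) : Prop :=
  (z - 3 * n + 4 ≤ 0 ∧ z - n - 2 * d + 2 = 0) ∨
    (0 < z - 3 * n + 4 ∧ d - n + 1 = 0 ∧ 0 ≤ 5 * n - z - 10)

/-- The number of zeros in a row of the adjacency matrix. -/
def rowZeros (G : SimpleGraph V) [DecidableRel G.Adj] (v : V) : ℕ :=
  (Finset.univ.filter fun w => ¬ G.Adj v w).card

theorem rowZeros_eq (v : V) : rowZeros G v = Gᶜ.degree v + 1 := by
  have : (Finset.univ.filter fun w => ¬ G.Adj v w) = insert v (Gᶜ.neighborFinset v) := by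
    ext w
    simp only [Finset.mem_filter, Finset.mem_univ, true_and, Finset.mem_insert,
      SimpleGraph.mem_neighborFinset, SimpleGraph.compl_adj]
    by_cases h : w = v
    · simp [h]
    · simp [h, Ne.symm h]
  rw [rowZeros, this, Finset.card_insert_of_notMem (by simp),
    SimpleGraph.card_neighborFinset_eq_degree]

/-- Diagonal entries count as zeros. With m edges and maximum degree D in the complement, z = 2m + n
and d = D + 1. The two alternatives are separated by whether m + 2 ≤ n. -/
theorem IsCobipartite.evc_eq_iff (hG : IsCobipartite G) (hV : 2 ≤ Fintype.card V) :
    evc G + 1 = Fintype.card V ↔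
      CountTest (Fintype.card V) (∑ v, rowZeros G v : ℕ) (Finset.univ.sup (rowZeros G) : ℕ) := by
  have : Nonempty V := Fintype.card_pos_iff.1 (by omega)
  obtain ⟨A, B, hAB⟩ := exists_isNormalizedPartition hG
  rw [hAB.evc_eq_iff, coStar_iff hV, hG.hasPendant_iff hV]
  have hz : ∑ v, rowZeros G v = 2 * Gᶜ.edgeFinset.card + Fintype.card V := by
    simp only [rowZeros_eq, Finset.sum_add_distrib, SimpleGraph.sum_degrees_eq_twice_card_edges]
    simp
  have hd : Finset.univ.sup (rowZeros G) = Gᶜ.maxDegree + 1 := by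
    apply le_antisymm
    · refine Finset.sup_le fun v _ => ?_
      rw [rowZeros_eq]
      exact Nat.succ_le_succ (Gᶜ.degree_le_maxDegree v)
    · obtain ⟨c, hc⟩ := Gᶜ.exists_maximal_degree_vertex
      rw [hc, ← rowZeros_eq]
      exact Finset.le_sup (Finset.mem_univ c)
  have hle : Gᶜ.maxDegree ≤ Gᶜ.edgeFinset.card := by
    obtain ⟨c, hc⟩ := Gᶜ.exists_maximal_degree_vertex
    rw [hc, ← SimpleGraph.card_incidenceFinset_eq_degree]
    exact Finset.card_le_card (SimpleGraph.incidenceFinset_subset _ c)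
  rw [hz, hd, CountTest]
  push_cast
  omega

/-- The value of `evc` can be compared with `k` by means of the counts. -/
theorem IsCobipartite.evc_le_iff (hG : IsCobipartite G) (k : ℕ) :
    evc G ≤ k ↔ Fintype.card V ≤ k + 1 ∨ (Fintype.card V = k + 2 ∧
      ¬ CountTest (Fintype.card V) (∑ v, rowZeros G v : ℕ)
        (Finset.univ.sup (rowZeros G) : ℕ)) := by
  rcases Nat.eq_zero_or_pos (Fintype.card V) with h0 | hpos
  · have := evc_le (guardsWin_card G)
    simp only [h0]
    omega
  have : Nonempty V := Fintype.card_pos_iff.1 hpos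
  obtain ⟨A, B, hAB⟩ := exists_isNormalizedPartition hG
  have h1 := hAB.toIsCliquePartition.evc_eq
  rw [hAB.toIsCliquePartition.card_add_card] at h1
  by_cases hk : Fintype.card V = k + 2
  · rw [← hG.evc_eq_iff (by omega)]
    omega
  · omega

end Counting
end EVC

namespace EVC

section Machine

open Computability Turing Turing.TM2.Stmt

/-! ### The machine -/

/-- The stacks: input and output, the bits of `k` and a scratch stack for them, two stacks that hold
the largest number of zeros in a row (the second part is the number of zeros of the current
row), and four counters. -/
inductive Stk
  | inp | out | bits | scratch | left | right
  | ctr (i : Fin 4)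
  deriving DecidableEq, Fintype

/-- The stack alphabets. -/
abbrev Stk.Alphabet : Stk → Type
  | .inp => Γ'
  | _ => Bool

/-- The labels of the machine. -/
inductive Label
  | readBits | scan | down | up | rewind | clean
  deriving DecidableEq

instance : Fintype Label :=
  ⟨{.readBits, .scan, .down, .up, .rewind, .clean}, fun l => by cases l <;> decide⟩

/-- The registers: the last symbols popped, the borrow of the subtraction, the deficit
(the number of rows in excess of `k`, capped at `3`) and the answer. -/
structure Reg where
  sym : Option Γ' := none
  bit : Option Bool := none
  borrow : Bool := false
  deficit : Fin 4 := 0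
  ans : Bool := false
  deriving Fintype

/-- The statements of the machine. -/
abbrev Prog : Type := TM2.Stmt Stk.Alphabet Label Reg

/-- Increments or decrements a counter. A counter is a stack of equal Booleans that indicate
its sign. -/
def bump (i : Fin 4) (up : Bool) (q : Prog) : Prog :=
  peek (.ctr i) (fun v o => { v with bit := o }) <|
  branch (fun v => decide (v.bit = some !up))
    (pop (.ctr i) (fun v _ => { v with bit := none }) q)
    (push (.ctr i) (fun _ => up) <| load (fun v => { v with bit := none }) q)

/-- Adds a constant to a counter. -/
def bumpBy (i : Fin 4) (z : ℤ) (q : Prog) : Prog :=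
  (bump i (decide (0 ≤ z)))^[z.natAbs] q

/-- Adds a constant vector to the counters. -/
def bumpAll (w : Fin 4 → ℤ) (q : Prog) : Prog :=
  bumpBy 0 (w 0) <| bumpBy 1 (w 1) <| bumpBy 2 (w 2) <| bumpBy 3 (w 3) q

/-- The contribution of a zero to the counters. -/
def weightZero : Fin 4 → ℤ := ![1, 1, 0, -1]

/-- The contribution of an increase of the row maximum to the counters. -/
def weightMax : Fin 4 → ℤ := ![-2, 0, 1, 0]

/-- The contribution of a row to the counters. -/
def weightRow : Fin 4 → ℤ := ![-1, -3, -1, 5]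

/-- The constant terms of the counters. -/
def weightConst : Fin 4 → ℤ := ![2, 4, 1, -10]

/-- Resets the scratch registers and jumps. -/
def jump (l : Label) : Prog :=
  load (fun v => { v with sym := none, bit := none }) <| goto fun _ => l

/-- Stores the answer, given the result of the counting test, and jumps to the clean-up. -/
def answer (test : Bool) : Prog :=
  load (fun v => { ans := decide (v.deficit ≤ 1) || (decide (v.deficit = 2) && !test) }) <|
  goto fun _ => .clean

/-- Pops all the given stacks, recording in a register whether one of them was nonempty. -/
def popAll (ks : List Stk) (q : Prog) : Prog :=
  ks.foldr (fun k q => pop k (fun v o => { v with bit := if o.isSome then some true else v.bit }) q)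
    q

/-- Moves a unit from the left to the right part of the row maximum and continues with `q₂`; if the
left part is empty, then only increases the right part and continues with `q₁`. -/
def advance (q₁ q₂ : Prog) : Prog :=
  pop .left (fun v o => { v with bit := o }) <|
  branch (fun v => v.bit.isNone)
    (push .right (fun _ => true) q₁)
    (load (fun v => { v with bit := none }) <| push .right (fun _ => true) q₂)

/-- The reaction to a zero of the matrix. -/
def onZero : Prog :=
  advance (bumpAll (weightZero + weightMax) <| jump .scan) (bumpAll weightZero <| jump .scan)

/-- The reaction to the end of a row. -/
def onComma : Prog :=
  bumpAll weightRow <|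
  branch (fun v => decide (v.deficit = 0)) (jump .down) <|
  load (fun v => { v with deficit := if v.deficit = 1 then 2 else 3 }) <| jump .rewind

/-- The evaluation of the counting test. -/
def onSigns : Prog :=
  peek (.ctr 1) (fun v o => { v with bit := o }) <|
  branch (fun v => decide (v.bit = some true))
    (peek (.ctr 2) (fun v o => { v with bit := o }) <|
      branch (fun v => v.bit.isNone)
        (peek (.ctr 3) (fun v o => { v with bit := o }) <|
          branch (fun v => decide (v.bit = some false)) (answer false) (answer true))
        (answer false))
    (peek (.ctr 0) (fun v o => { v with bit := o }) <|
      branch (fun v => v.bit.isNone) (answer true) (answer false))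

/-- The reaction to the end of the input. -/
def onEnd : Prog :=
  bumpAll weightConst onSigns

/-- Reads a symbol of the matrix and continues accordingly. -/
def readSymbol (q₁ q₂ q₃ q₄ : Prog) : Prog :=
  pop .inp (fun v o => { v with sym := o }) <|
  branch (fun v => decide (v.sym = some (.bit true))) q₁ <|
  branch (fun v => decide (v.sym = some (.bit false))) q₂ <|
  branch (fun v => decide (v.sym = some .comma)) q₃ q₄

/-- The program. -/
def program : Label → Prog
  | .readBits =>
    pop .inp (fun v o => { v with sym := o }) <|
    branch (fun v => decide (v.sym = some .ket)) (jump .scan) <|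
    push .bits (fun v => decide (v.sym = some (.bit true))) <| jump .readBits
  | .scan => readSymbol (jump .scan) onZero onComma onEnd
  | .down =>
    pop .bits (fun v o => { v with bit := o }) <|
    branch (fun v => v.bit.isNone)
      (load (fun v => { v with borrow := true }) <| jump .up) <|
    push .scratch (fun v => v.bit.getD false) <| jump .down
  | .up =>
    pop .scratch (fun v o => { v with bit := o }) <|
    branch (fun v => v.bit.isNone)
      (load (fun v => { v with deficit := if v.borrow then 1 else 0, borrow := false }) <|
        jump .rewind) <|
    push .bits (fun v => v.bit.getD false ^^ v.borrow) <|
    load (fun v => { v with borrow := v.borrow && !(v.bit.getD false) }) <| jump .up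
  | .rewind =>
    pop .right (fun v o => { v with bit := o }) <|
    branch (fun v => v.bit.isNone) (jump .scan) <|
    push .left (fun _ => true) <| jump .rewind
  | .clean =>
    popAll [.bits, .left, .ctr 0, .ctr 1, .ctr 2, .ctr 3] <|
    branch (fun v => v.bit.isNone)
      (push .out (fun v => v.ans) <| load (fun _ => {}) halt) <|
    jump .clean

/-- The configurations of the machine. -/
abbrev Config : Type := TM2.Cfg Stk.Alphabet Label Reg

/-- One configuration leads to another one in at most `n` steps. -/
def ReachesIn (n : ℕ) (a b : Config) : Prop :=
  ∃ t ≤ n, (flip bind (TM2.step program))^[t] (some a) = some b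

theorem ReachesIn.trans {m n : ℕ} {a b c : Config} (h₁ : ReachesIn m a b)
    (h₂ : ReachesIn n b c) : ReachesIn (m + n) a c := by
  obtain ⟨s, hs, h₁⟩ := h₁
  obtain ⟨t, ht, h₂⟩ := h₂
  refine ⟨t + s, by omega, ?_⟩
  rw [Function.iterate_add_apply, h₁, h₂]

theorem ReachesIn.mono {m n : ℕ} {a b : Config} (h : ReachesIn m a b) (hmn : m ≤ n) :
    ReachesIn n a b := by
  obtain ⟨s, hs, h⟩ := h
  exact ⟨s, hs.trans hmn, h⟩

theorem ReachesIn.head {n : ℕ} {a b c : Config} (h : TM2.step program a = some b)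
    (h' : ReachesIn n b c) : ReachesIn (n + 1) a c := by
  obtain ⟨t, ht, h'⟩ := h'
  refine ⟨t + 1, by omega, ?_⟩
  rw [Function.iterate_succ_apply]
  exact (congrArg _ h).trans h'

theorem ReachesIn.refl (a : Config) : ReachesIn 0 a a :=
  ⟨0, le_rfl, rfl⟩

theorem ReachesIn.single {a b : Config} (h : TM2.step program a = some b) : ReachesIn 1 a b :=
  ⟨1, le_rfl, h⟩

/-! ### The effect of the statements -/

/-- The stack that represents the value `z` of a counter. -/
def counter (z : ℤ) : List Bool :=
  List.replicate z.natAbs (decide (0 ≤ z))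

theorem counter_add_one (z : ℤ) :
    counter (z + 1) = if (counter z).head? = some false then (counter z).tail
      else true :: counter z := by
  unfold counter
  rcases lt_or_ge z 0 with hz | hz
  · obtain ⟨n, hn⟩ : ∃ n : ℕ, z = -(n + 1 : ℕ) := ⟨z.natAbs - 1, by omega⟩
    have h1 : z.natAbs = n + 1 := by omega
    have h2 : (z + 1).natAbs = n := by omega
    rw [h1, h2, decide_eq_false (by omega : ¬ 0 ≤ z)]
    rcases n with _ | n
    · simp
    · rw [decide_eq_false (by omega : ¬ 0 ≤ z + 1)]
      simp [List.replicate_succ]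
  · have h2 : (z + 1).natAbs = z.natAbs + 1 := by omega
    rw [h2, decide_eq_true hz, decide_eq_true (by omega : 0 ≤ z + 1), if_neg]
    · rfl
    · cases z.natAbs <;> simp [List.replicate_succ]

theorem counter_neg (z : ℤ) : counter (-z) = (counter z).map not := by
  unfold counter
  rcases eq_or_ne z 0 with rfl | hz
  · rfl
  · rw [Int.natAbs_neg, List.map_replicate]
    congr 1
    by_cases h : 0 ≤ z
    · rw [decide_eq_true h, decide_eq_false (by omega)]; rfl
    · rw [decide_eq_false h, decide_eq_true (by omega)]; rfl

/-- Flipping all signs reduces this to `counter_add_one`. -/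
theorem counter_sub_one (z : ℤ) :
    counter (z - 1) = if (counter z).head? = some true then (counter z).tail
      else false :: counter z := by
  have h := counter_add_one (-z)
  rw [show -z + 1 = -(z - 1) by ring, counter_neg, counter_neg] at h
  have h' := congrArg (List.map not) h
  simp only [List.map_map, Function.comp_def, Bool.not_not, List.map_id'] at h'
  rw [h', apply_ite (List.map not)]
  cases hc : counter z with
  | nil => simp
  | cons b l => cases b <;> simp [Function.comp_def]

theorem head?_counter_eq_true {z : ℤ} : (counter z).head? = some true ↔ 0 < z := by
  unfold counter
  rcases eq_or_ne z 0 with rfl | hz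
  · simp
  · obtain ⟨n, hn⟩ : ∃ n : ℕ, z.natAbs = n + 1 := ⟨z.natAbs - 1, by omega⟩
    rw [hn, List.replicate_succ]
    simp
    omega

theorem head?_counter_eq_false {z : ℤ} : (counter z).head? = some false ↔ z < 0 := by
  unfold counter
  rcases eq_or_ne z 0 with rfl | hz
  · simp
  · obtain ⟨n, hn⟩ : ∃ n : ℕ, z.natAbs = n + 1 := ⟨z.natAbs - 1, by omega⟩
    rw [hn, List.replicate_succ]
    simp

theorem head?_counter_eq_none {z : ℤ} : (counter z).head? = none ↔ z = 0 := by
  unfold counter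
  rw [List.head?_eq_none_iff, List.replicate_eq_nil_iff, Int.natAbs_eq_zero]

/-- The contents of the stacks. -/
structure Store where
  inp : List Γ'
  out : List Bool := []
  bits : List Bool
  scratch : List Bool := []
  left : ℕ
  right : ℕ := 0
  ctr : Fin 4 → ℤ

/-- The stacks described by a `Store`. -/
def Store.stk (s : Store) : ∀ k : Stk, List k.Alphabet
  | .inp => s.inp
  | .out => s.out
  | .bits => s.bits
  | .scratch => s.scratch
  | .left => List.replicate s.left true
  | .right => List.replicate s.right true
  | .ctr i => counter (s.ctr i)

variable (s : Store)

@[simp] theorem Store.stk_inp : s.stk .inp = s.inp := rfl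
@[simp] theorem Store.stk_bits : s.stk .bits = s.bits := rfl
@[simp] theorem Store.stk_scratch : s.stk .scratch = s.scratch := rfl
@[simp] theorem Store.stk_left : s.stk .left = List.replicate s.left true := rfl
@[simp] theorem Store.stk_right : s.stk .right = List.replicate s.right true := rfl
@[simp] theorem Store.stk_ctr (i : Fin 4) : s.stk (.ctr i) = counter (s.ctr i) := rfl

@[simp] theorem Store.update_inp (l : List Γ') :
    Function.update s.stk .inp l = { s with inp := l }.stk := by
  funext k; cases k <;> rfl

@[simp] theorem Store.update_bits (l : List Bool) :
    Function.update s.stk .bits l = { s with bits := l }.stk := by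
  funext k; cases k <;> rfl

@[simp] theorem Store.update_scratch (l : List Bool) :
    Function.update s.stk .scratch l = { s with scratch := l }.stk := by
  funext k; cases k <;> rfl

@[simp] theorem Store.update_left_tail :
    Function.update s.stk .left (List.replicate s.left true).tail =
      { s with left := s.left - 1 }.stk := by
  funext k; cases k <;> simp [Store.stk, Function.update]

@[simp] theorem Store.update_left_cons :
    Function.update s.stk .left (true :: List.replicate s.left true) =
      { s with left := s.left + 1 }.stk := by
  funext k; cases k <;> rfl

@[simp] theorem Store.update_right_tail :
    Function.update s.stk .right (List.replicate s.right true).tail =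
      { s with right := s.right - 1 }.stk := by
  funext k; cases k <;> simp [Store.stk, Function.update]

@[simp] theorem Store.update_right_cons :
    Function.update s.stk .right (true :: List.replicate s.right true) =
      { s with right := s.right + 1 }.stk := by
  funext k; cases k <;> rfl

theorem Store.update_ctr (i : Fin 4) (z : ℤ) :
    Function.update s.stk (.ctr i) (counter (s.ctr i + z)) =
      { s with ctr := s.ctr + Pi.single i z }.stk := by
  funext k
  cases k with
  | ctr j =>
    by_cases h : j = i
    · subst h; simp [Store.stk]
    · simp [Store.stk, h]
  | _ => rfl

/-- Both branches reset the scratch register, so bumps compose. They are part of one statement and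
take no machine step of their own. -/
theorem stepAux_bump (i : Fin 4) (up : Bool) (q : Prog) (v : Reg) (hv : v.bit = none) :
    TM2.stepAux (bump i up q) v s.stk =
      TM2.stepAux q v { s with ctr := s.ctr + Pi.single i (if up then 1 else -1) }.stk := by
  have hv' : ({ v with bit := none } : Reg) = v := by cases v; simp_all
  rw [← Store.update_ctr]
  cases up with
  | true =>
    rw [if_pos rfl, counter_add_one]
    by_cases h : (counter (s.ctr i)).head? = some false <;> simp [bump, h, hv']
  | false =>
    rw [if_neg (by decide), ← sub_eq_add_neg, counter_sub_one]
    by_cases h : (counter (s.ctr i)).head? = some true <;> simp [bump, h, hv']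

theorem stepAux_bumpBy (i : Fin 4) (z : ℤ) (q : Prog) (v : Reg) (hv : v.bit = none) :
    TM2.stepAux (bumpBy i z q) v s.stk =
      TM2.stepAux q v { s with ctr := s.ctr + Pi.single i z }.stk := by
  have key : ∀ (up : Bool) (n : ℕ) (s : Store), TM2.stepAux ((bump i up)^[n] q) v s.stk =
      TM2.stepAux q v
        { s with ctr := s.ctr + Pi.single i (n * if up then (1 : ℤ) else -1) }.stk := by
    intro up n
    induction n with
    | zero => intro s; simp
    | succ n ih =>
      intro s
      rw [Function.iterate_succ_apply', stepAux_bump _ _ _ _ _ hv, ih]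
      simp only [add_assoc, ← Pi.single_add]
      congr 5
      push_cast
      ring
  unfold bumpBy
  rw [key]
  congr 5
  by_cases h : 0 ≤ z
  · simp only [h, decide_true, if_true]; omega
  · simp only [h, decide_false, Bool.false_eq_true, if_false]; omega

theorem stepAux_bumpAll (w : Fin 4 → ℤ) (q : Prog) (v : Reg) (hv : v.bit = none) :
    TM2.stepAux (bumpAll w q) v s.stk = TM2.stepAux q v { s with ctr := s.ctr + w }.stk := by
  have hw : s.ctr + Pi.single 0 (w 0) + Pi.single 1 (w 1) + Pi.single 2 (w 2) +
      Pi.single 3 (w 3) = s.ctr + w := by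
    funext i
    fin_cases i <;> simp
  simp only [bumpAll, stepAux_bumpBy _ _ _ _ _ hv, hw]

end Machine
end EVC

namespace EVC

section Run

open Computability Turing Turing.TM2.Stmt

/-! ### The loops -/

/-- The configuration with a given label, deficit and stacks. -/
def config (l : Label) (d : Fin 4) (s : Store) : Config :=
  ⟨some l, { deficit := d }, s.stk⟩

/-- `encodeNat` writes the least significant bit first, so the most significant one ends on top.
This is why each decrement reverses the bits onto the scratch stack before subtracting. -/
theorem reachesIn_readBits (l : List Bool) (rest : List Γ') (d : Fin 4) (s : Store) :
    ReachesIn (l.length + 1)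
      (config .readBits d { s with inp := l.map Γ'.bit ++ Γ'.ket :: rest })
      (config .scan d { s with inp := rest, bits := l.reverse ++ s.bits }) := by
  induction l generalizing s with
  | nil => exact ReachesIn.single (by simp [config, program, jump])
  | cons b l ih =>
    have h := ih { s with bits := b :: s.bits }
    refine ReachesIn.head ?_ (by simpa using h)
    cases b <;> simp [config, program, jump]

theorem reachesIn_down (l : List Bool) (d : Fin 4) (s : Store) :
    ReachesIn (l.length + 1) (config .down d { s with bits := l })
      ⟨some .up, { deficit := d, borrow := true },
        { s with bits := [], scratch := l.reverse ++ s.scratch }.stk⟩ := by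
  induction l generalizing s with
  | nil => exact ReachesIn.single (by simp [config, program, jump])
  | cons b l ih =>
    have h := ih { s with scratch := b :: s.scratch }
    refine ReachesIn.head ?_ (by simpa using h)
    simp [config, program, jump]

/-- Subtracts a borrow from a binary number, given by its bits in increasing order of
significance. -/
def subBorrow : Bool → List Bool → List Bool × Bool
  | b, [] => ([], b)
  | b, x :: l => ((x ^^ b) :: (subBorrow (b && !x) l).1, (subBorrow (b && !x) l).2)

theorem length_subBorrow (b : Bool) (l : List Bool) : (subBorrow b l).1.length = l.length := by
  induction l generalizing b with
  | nil => rfl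
  | cons x l ih => simp [subBorrow, ih]

/-- The number with given bits in increasing order of significance. -/
def bitVal : List Bool → ℕ
  | [] => 0
  | b :: l => b.toNat + 2 * bitVal l

/-- Subtraction is exact modulo the power of two; the outgoing borrow records the wrap-around. -/
theorem bitVal_subBorrow (b : Bool) (l : List Bool) :
    bitVal (subBorrow b l).1 + b.toNat =
      bitVal l + (subBorrow b l).2.toNat * 2 ^ l.length := by
  induction l generalizing b with
  | nil => simp [subBorrow, bitVal]
  | cons x l ih =>
    have := ih (b && !x)
    simp only [subBorrow, bitVal, List.length_cons, pow_succ]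
    cases x <;> cases b <;> simp at this ⊢ <;> linarith

theorem bitVal_lt (l : List Bool) : bitVal l < 2 ^ l.length := by
  induction l with
  | nil => simp [bitVal]
  | cons x l ih =>
    simp only [bitVal, List.length_cons, pow_succ]
    cases x <;> simp <;> omega

theorem bitVal_encodeNat (k : ℕ) : bitVal (encodeNat k) = k := by
  have hpos : ∀ p : PosNum, bitVal (encodePosNum p) = (p : ℕ) := by
    intro p
    induction p with
    | one => rfl
    | bit0 p ih => simp [encodePosNum, bitVal, ih]; ring
    | bit1 p ih => simp [encodePosNum, bitVal, ih]; ring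
  have hnum : ∀ m : Num, bitVal (encodeNum m) = (m : ℕ) := by
    intro m
    cases m with
    | zero => rfl
    | pos p => exact hpos p
  rw [encodeNat, hnum, Num.to_of_nat]

theorem reachesIn_up (l : List Bool) (d : Fin 4) (b : Bool) (s : Store) :
    ReachesIn (l.length + 1)
      ⟨some .up, { deficit := d, borrow := b }, { s with scratch := l }.stk⟩
      (config .rewind (if (subBorrow b l).2 then 1 else 0)
        { s with scratch := [], bits := (subBorrow b l).1.reverse ++ s.bits }) := by
  induction l generalizing s b with
  | nil => exact ReachesIn.single (by simp [config, program, jump, subBorrow]; rfl)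
  | cons x l ih =>
    have h := ih (b && !x) { s with bits := (x ^^ b) :: s.bits }
    simp only [subBorrow, List.reverse_cons, List.append_assoc, List.singleton_append]
    refine ReachesIn.head ?_ h
    simp [program, jump]

theorem reachesIn_rewind (n : ℕ) (d : Fin 4) (s : Store) :
    ReachesIn (n + 1) (config .rewind d { s with right := n })
      (config .scan d { s with right := 0, left := s.left + n }) := by
  induction n generalizing s with
  | zero => exact ReachesIn.single (by simp [config, program, jump])
  | succ n ih =>
    have h := ih { s with left := s.left + 1 }
    rw [show s.left + (n + 1) = s.left + 1 + n by omega]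
    refine ReachesIn.head ?_ h
    have h1 := Store.update_right_tail { s with right := n + 1 }
    have h2 := Store.update_left_cons { s with right := n }
    simp only [Nat.add_sub_cancel, List.replicate_succ, List.tail_cons] at h1
    simp only [TM2.step, program, TM2.stepAux, config, jump, Store.stk_right, List.replicate_succ,
      List.head?_cons, List.tail_cons, Option.isNone_some, cond_false, h1]
    exact congrArg (fun S => some (TM2.Cfg.mk (some Label.rewind) _ S)) h2

/-! ### Scanning the matrix -/

/-- The values of the counters when `z` zeros and `n` full rows have been read and the largest
number of zeros in a row is `d`. -/
def tally (z d n : ℕ) : Fin 4 → ℤ :=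
  (z : ℤ) • weightZero + (d : ℤ) • weightMax + (n : ℤ) • weightRow

/-- The stacks while the matrix is being read. Here `r` is the number of zeros of the
current row. -/
def scanStore (inp : List Γ') (bits : List Bool) (z d n r : ℕ) : Store where
  inp := inp
  bits := bits
  left := d - r
  right := r
  ctr := tally z d n

section Symbols

variable (q₁ q₂ q₃ q₄ : Prog) (inp : List Γ') (u : Fin 4) (s : Store)

theorem stepAux_readSymbol_bit_true :
    TM2.stepAux (readSymbol q₁ q₂ q₃ q₄) { deficit := u }
      { s with inp := Γ'.bit true :: inp }.stk =
    TM2.stepAux q₁ { sym := some (.bit true), deficit := u } { s with inp := inp }.stk := by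
  simp [readSymbol]

theorem stepAux_readSymbol_bit_false :
    TM2.stepAux (readSymbol q₁ q₂ q₃ q₄) { deficit := u }
      { s with inp := Γ'.bit false :: inp }.stk =
    TM2.stepAux q₂ { sym := some (.bit false), deficit := u } { s with inp := inp }.stk := by
  simp [readSymbol]

theorem stepAux_readSymbol_comma :
    TM2.stepAux (readSymbol q₁ q₂ q₃ q₄) { deficit := u }
      { s with inp := Γ'.comma :: inp }.stk =
    TM2.stepAux q₃ { sym := some .comma, deficit := u } { s with inp := inp }.stk := by
  simp [readSymbol]

theorem stepAux_readSymbol_nil :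
    TM2.stepAux (readSymbol q₁ q₂ q₃ q₄) { deficit := u } { s with inp := [] }.stk =
    TM2.stepAux q₄ { deficit := u } { s with inp := [] }.stk := by
  simp [readSymbol]

theorem stepAux_jump (l : Label) (v : Reg) (S : ∀ k : Stk, List k.Alphabet) :
    TM2.stepAux (jump l) v S = ⟨some l, { v with sym := none, bit := none }, S⟩ :=
  rfl

theorem stepAux_advance_zero (b : Option Γ') :
    TM2.stepAux (advance q₁ q₂) { sym := b, deficit := u } { s with left := 0 }.stk =
      TM2.stepAux q₁ { sym := b, deficit := u }
        { s with left := 0, right := s.right + 1 }.stk := by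
  have h := Store.update_left_tail { s with left := 0 }
  simp only [List.replicate_zero, List.tail_nil, Nat.zero_sub] at h
  simp only [advance, TM2.stepAux, Store.stk_left, List.replicate_zero, List.head?_nil,
    List.tail_nil, Option.isNone_none, cond_true, Store.stk_right, h]
  rw [Store.update_right_cons { s with left := 0 }]

theorem stepAux_advance_succ (b : Option Γ') (n : ℕ) :
    TM2.stepAux (advance q₁ q₂) { sym := b, deficit := u } { s with left := n + 1 }.stk =
      TM2.stepAux q₂ { sym := b, deficit := u }
        { s with left := n, right := s.right + 1 }.stk := by
  have h := Store.update_left_tail { s with left := n + 1 }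
  simp only [List.replicate_succ, List.tail_cons, Nat.add_sub_cancel] at h
  simp only [advance, TM2.stepAux, Store.stk_left, List.replicate_succ, List.head?_cons,
    List.tail_cons, Option.isNone_some, cond_false, Store.stk_right, h]
  rw [Store.update_right_cons { s with left := n }]

end Symbols

/-- The left stack holds d - r units. A zero found when it is empty means r = d, so the row maximum
grows and `weightMax` is added as well. -/
theorem reachesIn_scan_bit (b : Bool) (inp : List Γ') (bits : List Bool) (z d n r : ℕ) (hr : r ≤ d)
    (u : Fin 4) :
    ReachesIn 1 (config .scan u (scanStore (Γ'.bit b :: inp) bits z d n r))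
      (config .scan u (scanStore inp bits (z + (!b).toNat) (max d (r + (!b).toNat)) n
        (r + (!b).toNat))) := by
  apply ReachesIn.single
  cases b with
  | true =>
    refine congrArg some ((stepAux_readSymbol_bit_true _ _ _ _ inp u
      (scanStore inp bits z d n r)).trans ?_)
    rw [stepAux_jump]
    simp [config, scanStore, hr]
  | false =>
    refine congrArg some ((stepAux_readSymbol_bit_false _ _ _ _ inp u
      (scanStore inp bits z d n r)).trans ?_)
    rcases Nat.eq_or_lt_of_le hr with rfl | hlt
    · have ht : tally z r n + (weightZero + weightMax) = tally (z + 1) (r + 1) n := by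
        unfold tally; push_cast; module
      have h := stepAux_advance_zero (bumpAll (weightZero + weightMax) (jump .scan))
        (bumpAll weightZero (jump .scan)) u (scanStore inp bits z r n r) (some (.bit false))
      rw [stepAux_bumpAll _ _ _ _ rfl, stepAux_jump] at h
      simp only [scanStore, Nat.sub_self, ht] at h ⊢
      refine h.trans ?_
      simp [config]
    · obtain ⟨m, hm⟩ : ∃ m, d - r = m + 1 := ⟨d - r - 1, by omega⟩
      have ht : tally z d n + weightZero = tally (z + 1) d n := by
        unfold tally; push_cast; module
      have h := stepAux_advance_succ (bumpAll (weightZero + weightMax) (jump .scan))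
        (bumpAll weightZero (jump .scan)) u (scanStore inp bits z d n r) (some (.bit false)) m
      rw [stepAux_bumpAll _ _ _ _ rfl, stepAux_jump] at h
      simp only [scanStore, hm, ht] at h ⊢
      refine h.trans ?_
      rw [max_eq_left (by simpa using hlt), show d - (r + (!false).toNat) = m by simp; omega]
      simp [config]

end Run
end EVC

namespace EVC

/-! ### Rows, the final decision and the clean-up -/

section Correctness

open Computability Turing Turing.TM2.Stmt

theorem reachesIn_scan_row (row : List Bool) (inp : List Γ') (bits : List Bool) (z d n r : ℕ)
    (hr : r ≤ d) (u : Fin 4) :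
    ReachesIn row.length (config .scan u (scanStore (row.map Γ'.bit ++ inp) bits z d n r))
      (config .scan u (scanStore inp bits (z + row.count false) (max d (r + row.count false)) n
        (r + row.count false))) := by
  induction row generalizing z d r with
  | nil => simpa [hr] using ReachesIn.refl _
  | cons b row ih =>
    have h1 := reachesIn_scan_bit b (row.map Γ'.bit ++ inp) bits z d n r hr u
    have h2 := ih (z + (!b).toNat) (max d (r + (!b).toNat)) (r + (!b).toNat) (le_max_right _ _)
    have h3 := (h1.trans h2).mono (n := (b :: row).length) (by simp; omega)
    have hc : (b :: row).count false = (!b).toNat + row.count false := by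
      cases b <;> simp [add_comm]
    have hmax : max (max d (r + (!b).toNat)) (r + (!b).toNat + row.count false) =
        max d (r + (b :: row).count false) := by
      rw [hc]; omega
    have hz : z + (!b).toNat + row.count false = z + (b :: row).count false := by
      rw [hc, add_assoc]
    have hr' : r + (!b).toNat + row.count false = r + (b :: row).count false := by
      rw [hc, add_assoc]
    rw [hmax, hz, hr'] at h3
    exact h3

/-- The register and the bit stack after the rows have been subtracted from `k`. -/
def Subtracted (k n : ℕ) (l : List Bool) (u : Fin 4) : Prop :=
  (u = 0 ∧ bitVal l + n = k) ∨ (0 < u.val ∧ u.val = min (n - k) 3)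

theorem stepAux_onComma (q : Option Γ') (u : Fin 4) (s : Store) :
    TM2.stepAux onComma { sym := q, deficit := u } s.stk =
      if u = 0 then config .down 0 { s with ctr := s.ctr + weightRow }
      else config .rewind (if u = 1 then 2 else 3) { s with ctr := s.ctr + weightRow } := by
  unfold onComma
  rw [stepAux_bumpAll _ _ _ _ rfl]
  by_cases hu : u = 0 <;> simp [hu, jump, config]

theorem reachesIn_comma {k n : ℕ} {l : List Bool} {u : Fin 4} (h : Subtracted k n l u)
    (inp : List Γ') (z d r : ℕ) (hr : r ≤ d) :
    ∃ l' u', l'.length = l.length ∧ Subtracted k (n + 1) l' u' ∧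
      ReachesIn (2 * l.length + r + 4)
        (config .scan u (scanStore (Γ'.comma :: inp) l.reverse z d n r))
        (config .scan u' (scanStore inp l'.reverse z d (n + 1) 0)) := by
  have ht : tally z d n + weightRow = tally z d (n + 1) := by
    unfold tally; push_cast; module
  have hstep : TM2.step program (config .scan u (scanStore (Γ'.comma :: inp) l.reverse z d n r)) =
      some (if u = 0 then config .down 0
          { scanStore inp l.reverse z d n r with ctr := tally z d (n + 1) }
        else config .rewind (if u = 1 then 2 else 3)
          { scanStore inp l.reverse z d n r with ctr := tally z d (n + 1) }) := by
    refine congrArg some ((stepAux_readSymbol_comma _ _ _ _ inp u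
      (scanStore inp l.reverse z d n r)).trans ?_)
    rw [stepAux_onComma]
    simp only [scanStore, ht]
  have hrew : ∀ (u' : Fin 4) (b : List Bool), ReachesIn (r + 1)
      (config .rewind u' { scanStore inp b z d n r with ctr := tally z d (n + 1) })
      (config .scan u' (scanStore inp b z d (n + 1) 0)) := by
    intro u' b
    have h := reachesIn_rewind r u'
      { scanStore inp b z d n r with ctr := tally z d (n + 1) }
    simpa only [scanStore, Nat.sub_add_cancel hr, Nat.sub_zero] using h
  by_cases hu : u = 0
  · rw [if_pos hu] at hstep
    have hk : bitVal l + n = k := by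
      rcases h with h | h
      · exact h.2
      · simp [hu] at h
    refine ⟨(subBorrow true l).1, if (subBorrow true l).2 then 1 else 0,
      length_subBorrow _ _, ?_, ?_⟩
    -- An outgoing borrow forces the old value to be 0, since the new one is below the power of two.
    -- Then k = n, and the row just read makes the deficit 1.
    · have h1 := bitVal_subBorrow true l
      have h2 := bitVal_lt (subBorrow true l).1
      rw [length_subBorrow] at h2
      cases hb : (subBorrow true l).2 with
      | true =>
        rw [hb] at h1
        simp only [Bool.toNat_true, one_mul] at h1
        right
        simp
        omega
      | false =>
        rw [hb] at h1
        simp only [Bool.toNat_true, Bool.toNat_false, zero_mul] at h1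
        left
        simp
        omega
    · have h1 := reachesIn_down l.reverse 0
        { scanStore inp l.reverse z d n r with ctr := tally z d (n + 1) }
      have h2 := reachesIn_up l 0 true
        { scanStore inp [] z d n r with ctr := tally z d (n + 1) }
      simp only [List.reverse_reverse, scanStore, List.append_nil, List.length_reverse] at h1 h2
      exact ((ReachesIn.head hstep h1).trans (h2.trans (hrew _ _))).mono (by omega)
  -- Once the deficit is positive the bits no longer matter. It may be capped at 3 because the
  -- verdict only asks whether it is at most 1 or equal to 2.
  · rw [if_neg hu] at hstep
    refine ⟨l, if u = 1 then 2 else 3, rfl, ?_, (ReachesIn.head hstep (hrew _ _)).mono (by omega)⟩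
    rcases h with h | h
    · exact absurd h.1 hu
    · right
      have : u = 1 ↔ u.val = 1 := Fin.ext_iff
      split_ifs with h1
      · have := this.1 h1
        simp; omega
      · have : u.val ≠ 1 := fun h => h1 (this.2 h)
        simp; omega

theorem reachesIn_rows (rows : List (List Bool)) (m : ℕ) (hm : ∀ row ∈ rows, row.length ≤ m)
    {k n : ℕ} {l : List Bool} {u : Fin 4} (h : Subtracted k n l u) (z d : ℕ) :
    ∃ l' u', l'.length = l.length ∧ Subtracted k (n + rows.length) l' u' ∧
      ReachesIn (rows.length * (2 * m + 2 * l.length + 4))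
        (config .scan u (scanStore
          (rows.flatMap fun row => row.map Γ'.bit ++ [Γ'.comma]) l.reverse z d n 0))
        (config .scan u' (scanStore [] l'.reverse (z + (rows.map (List.count false)).sum)
          (max d ((rows.map (List.count false)).foldr max 0)) (n + rows.length) 0)) := by
  induction rows generalizing n l u z d with
  | nil => exact ⟨l, u, rfl, h, by simpa using ReachesIn.refl _⟩
  | cons row rows ih =>
    have h1 := reachesIn_scan_row row
      (Γ'.comma :: rows.flatMap fun row => row.map Γ'.bit ++ [Γ'.comma]) l.reverse z d n 0
      (Nat.zero_le _) u
    obtain ⟨l₁, u₁, hl₁, hs₁, h2⟩ := reachesIn_comma h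
      (rows.flatMap fun row => row.map Γ'.bit ++ [Γ'.comma]) (z + row.count false)
      (max d (0 + row.count false)) (0 + row.count false) (le_max_right _ _)
    obtain ⟨l₂, u₂, hl₂, hs₂, h3⟩ := ih (fun r hr => hm r (List.mem_cons_of_mem _ hr)) hs₁
      (z + row.count false) (max d (0 + row.count false))
    have hrow := hm row List.mem_cons_self
    have hcount : row.count false ≤ row.length := List.count_le_length
    refine ⟨l₂, u₂, hl₂.trans hl₁, ?_, ?_⟩
    · rwa [List.length_cons, add_comm rows.length, ← add_assoc]
    · have h4 := (h1.trans (h2.trans h3)).mono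
        (n := (row :: rows).length * (2 * m + 2 * l.length + 4)) (by
          rw [hl₁, List.length_cons, add_one_mul]; omega)
      have e1 : z + row.count false + (rows.map (List.count false)).sum =
          z + ((row :: rows).map (List.count false)).sum := by
        simp [add_assoc]
      have e2 : max (max d (0 + row.count false)) ((rows.map (List.count false)).foldr max 0) =
          max d (((row :: rows).map (List.count false)).foldr max 0) := by
        simp [max_assoc]
      have e3 : n + 1 + rows.length = n + (row :: rows).length := by
        simp; omega
      have e4 : (row :: rows).flatMap (fun row => row.map Γ'.bit ++ [Γ'.comma]) =
          row.map Γ'.bit ++ Γ'.comma :: rows.flatMap fun row => row.map Γ'.bit ++ [Γ'.comma] := by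
        simp
      rw [e1, e2, e3] at h4
      rwa [e4]

/-! ### The decision and the clean-up -/

/-- The counting test in terms of the values of the counters. -/
def SignTest (c : Fin 4 → ℤ) : Prop :=
  (c 1 ≤ 0 ∧ c 0 = 0) ∨ (0 < c 1 ∧ c 2 = 0 ∧ 0 ≤ c 3)

/-- The answer, given the deficit and the result of the counting test. -/
def verdict (u : Fin 4) (test : Bool) : Bool :=
  decide (u ≤ 1) || (decide (u = 2) && !test)

open Classical in
theorem stepAux_onSigns (u : Fin 4) (s : Store) :
    TM2.stepAux onSigns { deficit := u } s.stk =
      ⟨some .clean, { ans := verdict u (decide (SignTest s.ctr)) }, s.stk⟩ := by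
  have hans : ∀ (b : Bool) (o : Option Bool), (b = true ↔ SignTest s.ctr) →
      TM2.stepAux (answer b) { deficit := u, bit := o } s.stk =
        ⟨some .clean, { ans := verdict u (decide (SignTest s.ctr)) }, s.stk⟩ := by
    intro b o hb
    have : b = decide (SignTest s.ctr) := by
      rw [Bool.eq_iff_iff, hb, decide_eq_true_iff]
    rw [← this]
    rfl
  have hnone : ∀ i, ((counter (s.ctr i)).head?).isNone = decide (s.ctr i = 0) := by
    intro i
    rw [Bool.eq_iff_iff, Option.isNone_iff_eq_none, head?_counter_eq_none, decide_eq_true_iff]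
  simp only [onSigns, TM2.stepAux, Store.stk_ctr, head?_counter_eq_true, head?_counter_eq_false,
    hnone]
  by_cases h1 : 0 < s.ctr 1
  · by_cases h2 : s.ctr 2 = 0
    · by_cases h3 : s.ctr 3 < 0
      · simp only [h1, h2, h3, decide_true, cond_true]
        exact hans _ _ (by simp [SignTest]; omega)
      · simp only [h1, h2, h3, decide_true, decide_false, cond_true, cond_false]
        exact hans _ _ (by simp [SignTest]; omega)
    · simp only [h1, h2, decide_true, decide_false, cond_true, cond_false]
      exact hans _ _ (by simp [SignTest]; omega)
  · by_cases h2 : s.ctr 0 = 0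
    · simp only [h1, h2, decide_true, decide_false, cond_true, cond_false]
      exact hans _ _ (by simp [SignTest]; omega)
    · simp only [h1, h2, decide_false, cond_false]
      exact hans _ _ (by simp [SignTest]; omega)

open Classical in
theorem reachesIn_end (u : Fin 4) (s : Store) :
    ReachesIn 1 (config .scan u { s with inp := [] })
      ⟨some .clean, { ans := verdict u (decide (SignTest (s.ctr + weightConst))) },
        { s with inp := [], ctr := s.ctr + weightConst }.stk⟩ := by
  refine ReachesIn.single (congrArg some ((stepAux_readSymbol_nil _ _ _ _ u s).trans ?_))
  unfold onEnd
  rw [stepAux_bumpAll _ _ _ _ rfl, stepAux_onSigns]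

theorem stepAux_popAll (ks : List Stk) (hks : ks.Nodup) (q : Prog) (v : Reg)
    (S : ∀ k : Stk, List k.Alphabet) :
    TM2.stepAux (popAll ks q) v S =
      TM2.stepAux q { v with bit := if ∀ k ∈ ks, S k = [] then v.bit else some true }
        fun k => if k ∈ ks then (S k).tail else S k := by
  induction ks generalizing v S with
  | nil => simp [popAll]
  | cons k ks ih =>
    have hk := (List.nodup_cons.1 hks).1
    have h := ih (List.nodup_cons.1 hks).2
      { v with bit := if (S k).head?.isSome then some true else v.bit }
      (Function.update S k (S k).tail)
    refine Eq.trans ?_ (h.trans ?_)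
    · rfl
    · have hS : (fun j => if j ∈ ks then (Function.update S k (S k).tail j).tail
          else Function.update S k (S k).tail j) =
          fun j => if j ∈ k :: ks then (S j).tail else S j := by
        funext j
        by_cases hj : j = k
        · subst hj; simp [hk]
        · simp [hj]
      have hall : (∀ j ∈ ks, Function.update S k (S k).tail j = []) ↔ ∀ j ∈ ks, S j = [] := by
        refine forall₂_congr fun j hj => ?_
        have : j ≠ k := by rintro rfl; exact hk hj
        rw [Function.update_of_ne this]
      rw [hS]
      congr 2
      simp only [hall, List.forall_mem_cons]
      cases hc : S k with
      | nil => simp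
      | cons a t => simp

/-- Each round pops all six stacks at once, so the tallest one bounds the number of rounds; one more
finds them empty and writes the answer. -/
theorem reachesIn_clean (m : ℕ) (a : Bool) (S : ∀ k : Stk, List k.Alphabet)
    (hS : ∀ k, (S k).length ≤ m) (h1 : S .inp = []) (h2 : S .out = []) (h3 : S .scratch = [])
    (h4 : S .right = []) :
    ReachesIn (m + 1) ⟨some .clean, { ans := a }, S⟩
      ⟨none, {}, Function.update (fun _ => []) .out [a]⟩ := by
  have hstep : ∀ S : ∀ k : Stk, List k.Alphabet,
      TM2.step program ⟨some .clean, { ans := a }, S⟩ = some (TM2.stepAux _ _ _) :=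
    fun S => congrArg some (stepAux_popAll _ (by decide) _ _ S)
  simp only [TM2.stepAux] at hstep
  induction m generalizing S with
  | zero =>
    refine ReachesIn.single ?_
    have hall : ∀ k, S k = [] := fun k => List.length_eq_zero_iff.1 (Nat.le_zero.1 (hS k))
    rw [hstep, if_pos fun k _ => hall k]
    simp only [Option.isNone_none, cond_true]
    congr 2
    funext k
    by_cases hk : k = .out
    · subst hk; simp [h2]
    · simp [hk, hall k]
  | succ m ih =>
    by_cases hall : ∀ k, S k = []
    · exact (ih S (fun k => by simp [hall k]) h1 h2 h3 h4).mono (by omega)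
    · have hstep' := hstep S
      rw [if_neg] at hstep'
      · simp only [Option.isNone_some, cond_false, stepAux_jump] at hstep'
        refine ReachesIn.head hstep' (ih _ (fun k => ?_) ?_ ?_ ?_ ?_)
        · cases k with
          | ctr i =>
            have := hS (.ctr i)
            fin_cases i <;> simp at this ⊢ <;> omega
          | _ =>
            first
            | (have := hS .left; have := hS .bits; simp [h1, h2, h3, h4] at *; omega)
            | simp [h1, h2, h3, h4]
        all_goals simp [h1, h2, h3, h4]
      · intro hcon
        refine hall fun k => ?_
        cases k with
        | ctr i => fin_cases i <;> exact hcon _ (by decide)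
        | inp => exact h1
        | out => exact h2
        | scratch => exact h3
        | right => exact h4
        | _ => exact hcon _ (by decide)

end Correctness
end EVC

namespace EVC

/-! ### The machine decides the problem in polynomial time -/

section Decision

open Computability Turing Turing.TM2.Stmt

/-- The weights are the coefficients of the four linear forms in `CountTest`. -/
theorem signTest_iff (z d n : ℕ) : SignTest (tally z d n + weightConst) ↔ CountTest n z d := by
  have h0 : (tally z d n + weightConst) 0 = (z : ℤ) - n - 2 * d + 2 := by
    simp [tally, weightZero, weightMax, weightRow, weightConst]; ring
  have h1 : (tally z d n + weightConst) 1 = (z : ℤ) - 3 * n + 4 := by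
    simp [tally, weightZero, weightMax, weightRow, weightConst]; ring
  have h2 : (tally z d n + weightConst) 2 = (d : ℤ) - n + 1 := by
    simp [tally, weightZero, weightMax, weightRow, weightConst]; ring
  have h3 : (tally z d n + weightConst) 3 = 5 * (n : ℤ) - z - 10 := by
    simp [tally, weightZero, weightMax, weightRow, weightConst]; ring
  rw [SignTest, h0, h1, h2, h3, CountTest]

open Classical in
theorem reachesIn_program (l : List Bool) (rows : List (List Bool)) (m : ℕ)
    (hm : ∀ row ∈ rows, row.length ≤ m) (z d : ℕ) (hz : (rows.map (List.count false)).sum = z)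
    (hd : (rows.map (List.count false)).foldr max 0 = d) :
    ReachesIn (2 * l.length + rows.length * (2 * m + 2 * l.length + 4) + z + 3 * d +
        5 * rows.length + 13)
      (config .readBits 0
        { inp := l.map Γ'.bit ++ Γ'.ket :: rows.flatMap fun row => row.map Γ'.bit ++ [Γ'.comma]
          bits := [], left := 0, ctr := 0 })
      ⟨none, {}, Function.update (fun _ => []) .out
        [decide (rows.length ≤ bitVal l + 1 ∨
          (rows.length = bitVal l + 2 ∧ ¬ CountTest rows.length z d))]⟩ := by
  have h1 := reachesIn_readBits l (rows.flatMap fun row => row.map Γ'.bit ++ [Γ'.comma]) 0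
    { inp := [], bits := [], left := 0, ctr := 0 }
  have hsub : Subtracted (bitVal l) 0 l 0 := Or.inl ⟨rfl, rfl⟩
  obtain ⟨l', u, hl', hu, h2⟩ := reachesIn_rows rows m hm hsub 0 0
  rw [Nat.zero_add, Nat.zero_add, hz, hd, Nat.zero_max] at h2
  have hscan : ∀ inp bits, scanStore inp bits 0 0 0 0 =
      { inp := inp, bits := bits, left := 0, ctr := 0 } := by
    intro inp bits
    simp [scanStore, tally]
  rw [hscan] at h2
  simp only [List.append_nil] at h1
  have h3 := reachesIn_end u (scanStore [] l'.reverse z d rows.length 0)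
  rw [show (scanStore [] l'.reverse z d rows.length 0).ctr = tally z d rows.length from rfl,
    decide_eq_decide.2 (signTest_iff z d rows.length)] at h3
  have hv : verdict u (decide (CountTest rows.length z d)) =
      decide (rows.length ≤ bitVal l + 1 ∨
          (rows.length = bitVal l + 2 ∧ ¬ CountTest rows.length z d)) := by
    rw [Nat.zero_add] at hu
    have hle : u ≤ 1 ↔ u.val ≤ 1 := Fin.le_def
    have heq : u = 2 ↔ u.val = 2 := Fin.ext_iff
    have h0 : u = 0 ↔ u.val = 0 := Fin.ext_iff
    rw [Subtracted, h0] at hu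
    rw [verdict, Bool.eq_iff_iff]
    simp only [Bool.or_eq_true, Bool.and_eq_true, decide_eq_true_iff, Bool.not_eq_true',
      decide_eq_false_iff_not, hle, heq]
    by_cases ht : CountTest rows.length z d <;> simp only [ht, not_true, not_false_iff, and_true,
      and_false, or_false] <;> omega
  rw [hv] at h3
  -- This height dominates the bit stack, the row maximum and the absolute values of the four linear
  -- forms.
  have h4 := reachesIn_clean (l.length + z + 3 * d + 5 * rows.length + 10)
    (decide (rows.length ≤ bitVal l + 1 ∨
      (rows.length = bitVal l + 2 ∧ ¬ CountTest rows.length z d)))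
    { scanStore [] l'.reverse z d rows.length 0 with
      inp := [], ctr := tally z d rows.length + weightConst }.stk
    (by
      intro k
      cases k with
      | ctr i =>
        rw [Store.stk_ctr, counter, List.length_replicate]
        fin_cases i <;>
          simp [tally, weightZero, weightMax, weightRow, weightConst] <;> omega
      | bits => simp [scanStore, hl']; omega
      | left => simp [scanStore]; omega
      | _ => simp [scanStore, Store.stk])
    rfl rfl rfl rfl
  exact (h1.trans (h2.trans (h3.trans h4))).mono (by omega)

/-- The machine. -/
def machine : FinTM2 where
  K := Stk
  k₀ := .inp
  k₁ := .out
  Γ := Stk.Alphabet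
  Λ := Label
  main := .readBits
  σ := Reg
  initialState := {}
  Γk₀Fin := inferInstanceAs (Fintype Γ')
  m := program

theorem initList_machine (l : List Γ') :
    initList machine l =
      config .readBits 0 { inp := l, bits := [], left := 0, ctr := 0 } := by
  refine congrArg (TM2.Cfg.mk (some Label.readBits) _) ?_
  funext k
  cases k <;> rfl

theorem haltList_machine (l : List Bool) :
    haltList machine l = (⟨none, {}, Function.update (fun _ => []) .out l⟩ : Config) := by
  refine congrArg (TM2.Cfg.mk none _) ?_
  funext k
  cases k <;> rfl

open Classical in
/-- The rows of the adjacency matrix. -/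
noncomputable def Instance.rows (x : Instance) : List (List Bool) :=
  (List.finRange x.n).map fun i => (List.finRange x.n).map fun j => decide (x.graph.Adj i j)

theorem Instance.encode_eq (x : Instance) :
    x.encode = (encodeNat x.k).map Γ'.bit ++
      Γ'.ket :: x.rows.flatMap fun row => row.map Γ'.bit ++ [Γ'.comma] := by
  simp [Instance.encode, Instance.rows, List.flatMap_map, Function.comp_def]

theorem Instance.length_rows (x : Instance) : x.rows.length = x.n := by
  simp [Instance.rows]

theorem Instance.length_of_mem_rows (x : Instance) : ∀ row ∈ x.rows, row.length = x.n := by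
  simp [Instance.rows]

theorem Instance.length_encode (x : Instance) :
    x.encode.length = (encodeNat x.k).length + 1 + x.n * (x.n + 1) := by
  simp [Instance.encode, List.length_flatMap]
  ring

open Classical in
theorem Instance.map_count_rows (x : Instance) :
    x.rows.map (List.count false) = (List.finRange x.n).map (rowZeros x.graph) := by
  rw [Instance.rows, List.map_map]
  refine List.map_congr_left fun i _ => ?_
  rw [Function.comp_apply, rowZeros, List.count, List.countP_map, List.countP_eq_length_filter,
    Fin.univ_def, Finset.card_def, Finset.filter_val, Multiset.filter_coe, Multiset.coe_card]
  congr 2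
  funext j
  simp

theorem foldr_max_finRange (n : ℕ) (f : Fin n → ℕ) :
    ((List.finRange n).map f).foldr max 0 = Finset.univ.sup f := by
  rw [Finset.sup_def, Fin.univ_def, Multiset.map_coe, Multiset.sup_coe]
  rfl

open Classical in
theorem polyTimeDecidableOn_cobipartite :
    PolyTimeDecidableOn {x | IsCobipartite x.graph} (fun x => evc x.graph ≤ x.k) := by
  have key : ∀ x : {x : Instance | IsCobipartite x.graph}, ∃ t ≤
      (2 * Polynomial.X ^ 2 + 18 * Polynomial.X + 13 : Polynomial ℕ).eval x.1.encode.length,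
      (flip bind (TM2.step program))^[t] (some (initList machine x.1.encode)) =
        some (haltList machine [decide (evc x.1.graph ≤ x.1.k)]) := by
    rintro ⟨x, hx⟩
    have hG : IsCobipartite x.graph := hx
    have hsum : (x.rows.map (List.count false)).sum = ∑ v, rowZeros x.graph v := by
      rw [x.map_count_rows, Fin.sum_univ_def]
    have hsup : (x.rows.map (List.count false)).foldr max 0 =
        Finset.univ.sup (rowZeros x.graph) := by
      rw [x.map_count_rows, foldr_max_finRange]
    have h := reachesIn_program (encodeNat x.k) x.rows x.n
      (fun row hrow => (x.length_of_mem_rows row hrow).le) _ _ hsum hsup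
    rw [← x.encode_eq, ← initList_machine, x.length_rows, bitVal_encodeNat, ← haltList_machine]
      at h
    have hiff := hG.evc_le_iff x.k
    rw [Fintype.card_fin] at hiff
    rw [← decide_eq_decide.2 hiff] at h
    have hrow : ∀ v, rowZeros x.graph v ≤ x.n := fun v =>
      (Finset.card_le_univ _).trans (by simp)
    have hz : ∑ v, rowZeros x.graph v ≤ x.n * x.n := by
      simpa using Finset.sum_le_card_nsmul Finset.univ (rowZeros x.graph) x.n fun v _ => hrow v
    have hd : Finset.univ.sup (rowZeros x.graph) ≤ x.n := Finset.sup_le fun v _ => hrow v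
    refine h.mono ?_
    simp only [Polynomial.eval_add, Polynomial.eval_mul, Polynomial.eval_pow, Polynomial.eval_X,
      Polynomial.eval_ofNat]
    have hL := x.length_encode
    set L := x.encode.length
    set b := (encodeNat x.k).length
    -- With L = b + 1 + n(n + 1), all terms are linear in L except the 2nb spent on decrementing k
    -- once per row; this one is absorbed by the square.
    nlinarith [Nat.zero_le (x.n * b), Nat.zero_le (x.n ^ 3)]
  choose t ht hrun using key
  refine ⟨{
    tm := machine
    inputAlphabet := Equiv.refl Γ'
    outputAlphabet := Equiv.refl Bool
    time := 2 * Polynomial.X ^ 2 + 18 * Polynomial.X + 13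
    outputsFun := fun x => ⟨⟨t x, ?_⟩, ht x⟩ }, ?_⟩
  · have h1 : List.map (Equiv.refl Γ').invFun x.1.encode = x.1.encode := List.map_id _
    refine (congrArg (fun l => (flip bind (TM2.step program))^[t x] (some (initList machine l)))
      h1).trans ((hrun x).trans ?_)
    exact congrArg (fun b => some (haltList machine [b])) (decide_eq_decide.2 Iff.rfl)
  · intro k
    change Finite (Stk.Alphabet k)
    cases k
    · exact inferInstanceAs (Finite Γ')
    all_goals exact inferInstanceAs (Finite Bool)

end Decision

end EVC
theorem theorem2 :
    -- Eternal Vertex Cover is solvable in polynomial time on cobipartite graphs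
    EVC.PolyTimeDecidableOn {x | EVC.IsCobipartite x.graph} (fun x => EVC.evc x.graph ≤ x.k) ∧
    -- every cobipartite graph has a normalized partition into two cliques
    (∀ (V : Type u) [Fintype V] (G : SimpleGraph V), EVC.IsCobipartite G →
      ∃ A B : Finset V, EVC.IsNormalizedPartition G A B) ∧
    -- the two possible values
    (∀ (V : Type u) [Fintype V] [Nonempty V] (G : SimpleGraph V) (A B : Finset V),
      EVC.IsCliquePartition G A B →
        EVC.evc G + 2 = A.card + B.card ∨ EVC.evc G + 1 = A.card + B.card) ∧
    -- which of the two values is attained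
    (∀ (V : Type u) [Fintype V] [Nonempty V] (G : SimpleGraph V) (A B : Finset V),
      EVC.IsNormalizedPartition G A B →
        (A.card = 0 → EVC.evc G + 1 = A.card + B.card) ∧
        (A.card = 1 →
          (EVC.evc G + 2 = A.card + B.card ↔ ∀ a ∈ A, ∀ b ∈ B, ¬ G.Adj a b)) ∧
        (A.card = 2 → B.card = 2 →
          (EVC.evc G + 2 = A.card + B.card ↔
            (∀ a ∈ A, ∀ b ∈ B, ¬ G.Adj a b) ∨
            ((∀ a ∈ A, ∃! b, b ∈ B ∧ G.Adj a b) ∧ (∀ b ∈ B, ∃! a, a ∈ A ∧ G.Adj a b)))) ∧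
        (A.card = 2 → 2 < B.card →
          (EVC.evc G + 1 = A.card + B.card ↔
            (∃! a, a ∈ A ∧ ∃ b ∈ B, G.Adj a b) ∨
            (∃! b, b ∈ B ∧ ¬ EVC.IsGlobal G b))) ∧
        (3 ≤ A.card →
          (EVC.evc G + 1 = A.card + B.card ↔ ∃! b, b ∈ B ∧ ¬ EVC.IsGlobal G b))) := by
  refine ⟨EVC.polyTimeDecidableOn_cobipartite, fun V _ G hG => EVC.exists_isNormalizedPartition hG,
    fun V _ _ G A B h => h.evc_eq, fun V _ _ G A B h => ?_⟩
  have hor := h.toIsCliquePartition.evc_eq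
  refine ⟨h.toIsCliquePartition.evc_eq_of_card_left_eq_zero, h.evc_eq_iff_of_card_left_eq_one,
    fun hA hB => ?_, fun hA hB => ?_, fun hA => ?_⟩
  -- Since only two values are possible, n - 2 is attained exactly when the criterion for n - 1
  -- fails.
  · rw [← h.matching_iff hA hB]
    have := h.evc_eq_iff_of_two_le hA.ge
    simp only [hA, true_and] at this hor ⊢
    rw [← this]
    omega
  · simpa only [hA, true_and] using h.evc_eq_iff_of_two_le hA.ge
  · rw [h.evc_eq_iff_of_two_le (by omega)]
    simp only [show A.card ≠ 2 by omega, false_and, false_or]
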